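/- **Setting.** Let $F=f+r$ on $\mathbb R^d$, $f=\frac1n\sum_{i=1}^n f_i$, where $r:\mathbb R^d\to\mathbb R\cup\{+\infty\}$ is proper and lower semicontinuous, $\inf F>-\infty$, each $f_i:\mathbb R^d\to\mathbb R$ is continuously differentiable, and $\frac1n\sum_i\|\nabla f_i(x)-\nabla f_i(y)\|^2\le L^2\|x-y\|^2$ for all $x,y$, with $L>0$. Let $u:\mathbb R^d\times\mathbb R^d\to\mathbb R\cup\{+\infty\}$ be a surrogate of $r$, i.e. $u(y,y)=r(y)$ and $u(x,y)\ge r(x)$, such that $u(x,\cdot)$ is continuous, $u(\cdot,y)$ is convex and lower semicontinuous, and $u(\cdot,y)-r\le \bar h(\cdot,y)$ for some $\bar h:\mathbb R^d\times\mathbb R^d\to\mathbb R\cup\{+\infty\}$ with $\bar h(\cdot,y)$ continuously differentiable around $y$, $\bar h(y,y)=0$ and $\nabla\bar h(\cdot,y)(y)=0$. With $\partial$ the limiting subdifferential, let $S\subseteq\mathbb R^d$ be an open convex set and $L_u\ge0$ a constant such that for all $x,y\in S$ and $\nu\in\partial u(\cdot,y)(x)$ there is $\zeta\in\partial r(x)$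 with $\|\nu-\zeta\|\le L_u\|x-y\|$; assume that the iterates below lie in $S$ almost surely (for instance, $S$ is a ball containing a bounded sequence of iterates, or $S=\mathbb R^d$ if $L_u$ is a global constant). **Algorithms.** Given a deterministic $x^0$, for $k=0,1,2,\dots$ a batch $I_k$ of $b$ indices, independent and uniform on $\{1,\dots,n\}$ (repetitions allowed), is drawn, and $$x^{k+1}=\operatorname*{argmin}_x\ \tfrac{\mu}{2}\|x-x^k\|^2+\langle g^k,x\rangle+u(x,x^k),$$ where * MM-SAGA: $g^k=\frac1b\sum_{i\in I_k}(\nabla f_i(x^k)-\nabla f_i(x_i^{k-1}))+\frac1n\sum_{i=1}^n\nabla f_i(x_i^{k-1})$, with $x_i^{-1}=x^0$, $x_i^k=x^k$ if $i\in I_k$ and $x_i^k=x_i^{k-1}$ otherwise; * MM-SVRG: $g^k=\frac1b\sum_{i\in I_k}(\nabla f_i(x^k)-\nabla f_i(\tilde x^k))+\nabla f(\tilde x^k)$, with $\tilde x^{-1}=x^0$, $\tilde x^k=x^k$ with probability $1/m$ and $\tilde x^k=\tilde x^{k-1}$ otherwise; * MM-SARAH: $g^k=\nabla f(x^k)$ with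 probability $1/m$ and $g^k=\frac1b\sum_{i\in I_k}(\nabla f_i(x^k)-\nabla f_i(x^{k-1}))+g^{k-1}$ otherwise, with $x^{-1}=x^0$, $g^{-1}=\nabla f(x^0)$. The coins with probability $1/m$ are independent of each other and of the batches; $m$ is a positive integer. The convergence condition is $(2\mu-L)^2-4(V+V_\Upsilon/\rho)>0$, with $(V,V_\Upsilon,\rho)$ equal to $\bigl(0,\frac{(2n-b)L^2}{b^2},\frac{b}{2n}\bigr)$ for MM-SAGA, $\bigl(0,\frac{(2m-1)L^2}{b},\frac1{2m}\bigr)$ for MM-SVRG and $\bigl(\frac{L^2}{b},\frac{(m-1)L^2}{mb},\frac1m\bigr)$ for MM-SARAH. **Claim 1 (condition).** Let $\mu=L$. For MM-SAGA with $b=\lfloor 4^{2/3}n^{2/3}\rfloor$, $n\ge1$, and for MM-SVRG with $b=\lfloor n^{2/3}\rfloor$, $m=\lfloor\sqrt b/4\rfloor\ge1$, the convergence condition holds. For MM-SARAH with $b=\lfloor n^{1/2}\rfloor$, $m=\lfloor b/4\rfloor\ge1$, it holds with $\ge0$ in place of $>0$, and with strict inequality if $4\nmid b$. **Claim 2 (complexity).**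 For all $L>0$, $L_u\ge0$, $D\ge0$ there is $C>0$ such that for every $\varepsilon\in(0,1]$ there is an integer $1\le K\le C/\varepsilon^2$ such that, for all $n$, $d$ and all data as above with these $L$, $L_u$ and with $F(x^0)-\inf F\le D$, each of the three algorithms with $\mu=L$ and the parameters of Claim 1 (with $b<n$ for MM-SAGA and $m\ge1$ for the other two) satisfies $$\min_{1\le k\le K}\mathbb E\,\operatorname{dist}^2(0,\partial F(x^k))\le\varepsilon^2,$$ and the expected number of evaluations of component gradients $\nabla f_i$ in its first $K$ iterations is at most $C\,n^{2/3}/\varepsilon^2$ for MM-SAGA, $C\,n^{2/3}/\varepsilon^2$ for MM-SVRG, and $C\,n^{1/2}/\varepsilon^2$ for MM-SARAH. (Not counted are the $n$ evaluations at $x^0$ before the first iteration. An iteration of MM-SAGA costs $b$; one of MM-SVRG costs $2b$, plus $n$ if $\tilde x^k=x^k$ is drawn; one of MM-SARAH costs $n$ if the full gradient is drawn and $2b$ otherwise.) -/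

import Mathlib

open Filter Topology MeasureTheory ProbabilityTheory
open scoped ENNReal

/-- The Euclidean space `ℝ^d`. -/
abbrev EucSp (d : ℕ) : Type := EuclideanSpace ℝ (Fin d)

/-! ### Subdifferentials of extended-real-valued functions -/

/-- Fréchet subdifferential: the vectors `v` for which
`liminf_{y → x, y ≠ x} (g y - g x - ⟪v, y - x⟫) / ‖y - x‖ ≥ 0`, written with epsilons;
it is empty where `g` is not finite. -/
def frechetSubdiff {d : ℕ} (g : EucSp d → EReal) (x : EucSp d) : Set (EucSp d) :=
  {v | g x ≠ ⊤ ∧ ∀ δ : ℝ, 0 < δ → ∀ᶠ y in 𝓝 x,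
    g x + ((inner ℝ v (y - x) - δ * ‖y - x‖ : ℝ) : EReal) ≤ g y}

/-- Limiting subdifferential. -/
def limitingSubdiff {d : ℕ} (g : EucSp d → EReal) (x : EucSp d) : Set (EucSp d) :=
  {v | g x ≠ ⊤ ∧ ∃ (xs vs : ℕ → EucSp d), Tendsto xs atTop (𝓝 x) ∧
    Tendsto (fun j => g (xs j)) atTop (𝓝 (g x)) ∧
    (∀ j, vs j ∈ frechetSubdiff g (xs j)) ∧ Tendsto vs atTop (𝓝 v)}

/-! ### The problem and the standing assumptions -/

/-- The finite sum `f = (1/n) ∑ f_i`. -/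
noncomputable def avgFun {n d : ℕ} (f : Fin n → EucSp d → ℝ) (x : EucSp d) : ℝ :=
  (1 / (n : ℝ)) * ∑ i, f i x

/-- The full gradient `∇f = (1/n) ∑ ∇f_i` (for differentiable `f_i`). -/
noncomputable def avgGrad {n d : ℕ} (f : Fin n → EucSp d → ℝ) (x : EucSp d) : EucSp d :=
  (1 / (n : ℝ)) • ∑ i, gradient (f i) x

/-- The objective `F = f + r`. -/
noncomputable def objective {n d : ℕ} (f : Fin n → EucSp d → ℝ) (r : EucSp d → EReal)
    (x : EucSp d) : EReal :=
  (avgFun f x : EReal) + r x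

/-- `r : ℝ^d → ℝ ∪ {+∞}` is proper and lower semicontinuous, `F = f + r` is bounded below, the
`f_i` are continuously differentiable, and their gradients are `L`-Lipschitz in mean square. -/
structure BasicAssumption {n d : ℕ} (f : Fin n → EucSp d → ℝ) (r : EucSp d → EReal)
    (L : ℝ) : Prop where
  ne_bot : ∀ x, r x ≠ ⊥
  proper : ∃ x, r x ≠ ⊤
  lsc : LowerSemicontinuous r
  bddBelow : (⨅ x, objective f r x) ≠ ⊥
  contDiff : ∀ i, ContDiff ℝ 1 (f i)
  avgSmooth : ∀ x y : EucSp d,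
    (1 / (n : ℝ)) * ∑ i, ‖gradient (f i) x - gradient (f i) y‖ ^ 2 ≤ L ^ 2 * ‖x - y‖ ^ 2

/-- `u` is a surrogate of `r`; the point of tangency is the second argument. -/
structure IsSurrogate {d : ℕ} (r : EucSp d → EReal) (u : EucSp d → EucSp d → EReal) : Prop where
  tangent : ∀ y, u y y = r y
  majorant : ∀ x y, r x ≤ u x y

/-- Convexity of a function with values in `ℝ ∪ {+∞}`. -/
def ExtConvex {d : ℕ} (g : EucSp d → EReal) : Prop :=
  ∀ x z : EucSp d, ∀ t : ℝ, 0 < t → t < 1 →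
    g ((1 - t) • x + t • z) ≤ ((1 - t : ℝ) : EReal) * g x + (t : EReal) * g z

/-- The assumptions on the surrogate: continuity in the second argument, lower semicontinuity and
convexity in the first one, and an approximation error `u(·,y) - r ≤ h(·,y)`, where `h(·,y)` is
continuously differentiable around `y`, and it and its gradient vanish at `y`. -/
structure SurrogateAssumption {d : ℕ} (r : EucSp d → EReal)
    (u : EucSp d → EucSp d → EReal) : Prop where
  continuous_snd : ∀ x, Continuous (u x)
  lsc_fst : ∀ y, LowerSemicontinuous fun x => u x y
  convex_fst : ∀ y, ExtConvex fun x => u x y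
  error : ∃ h : EucSp d → EucSp d → EReal, (∀ x y, h x y ≠ ⊥) ∧
    (∀ x y, u x y ≤ r x + h x y) ∧
    ∀ y, ∃ h₀ : EucSp d → ℝ, (∀ᶠ x in 𝓝 y, h x y = (h₀ x : EReal)) ∧
      ContDiffAt ℝ 1 h₀ y ∧ h₀ y = 0 ∧ gradient h₀ y = 0

/-- On `S`, every subgradient of `u(·,y)` at `x` is within `Lu * ‖x - y‖` of a subgradient of `r`
at `x`. -/
def SubgradientBound {d : ℕ} (r : EucSp d → EReal) (u : EucSp d → EucSp d → EReal)
    (S : Set (EucSp d)) (Lu : ℝ) : Prop :=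
  ∀ x ∈ S, ∀ y ∈ S, ∀ ν ∈ limitingSubdiff (fun z => u z y) x,
    ∃ ζ ∈ limitingSubdiff r x, ‖ν - ζ‖ ≤ Lu * ‖x - y‖

/-- All assumptions on the data: the two assumptions above, the subgradient bound with constant
`Lu` on an open convex set `S`, and `F(x0) - inf F ≤ D`. -/
structure ProblemAssumption {n d : ℕ} (f : Fin n → EucSp d → ℝ) (r : EucSp d → EReal)
    (u : EucSp d → EucSp d → EReal) (S : Set (EucSp d)) (x0 : EucSp d) (L Lu D : ℝ) : Prop where
  basic : BasicAssumption f r L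
  surrogate : IsSurrogate r u
  surrogateReg : SurrogateAssumption r u
  isOpen : IsOpen S
  convex : Convex ℝ S
  subgradient : SubgradientBound r u S Lu
  gap : objective f r x0 ≤ (⨅ x, objective f r x) + (D : EReal)

/-! ### Randomness -/

/-- The batches `I k = (i_1, …, i_b)` are lists of indices, all of them (over all iterations and
positions) independent and uniform on the `n` indices. -/
structure IsSampling {Ω : Type*} [MeasurableSpace Ω] (P : Measure Ω) {n b : ℕ}
    (I : ℕ → Ω → Fin b → Fin n) : Prop where
  measurable : ∀ k j, Measurable fun ω => I k ω j
  uniform : ∀ k j i, P {ω | I k ω j = i} = (n : ℝ≥0∞)⁻¹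
  indep : iIndepFun (fun (p : ℕ × Fin b) ω => I p.1 ω p.2) P

/-- The coins `c k` are independent, independent of the batches, and show `true` with
probability `1/m`. -/
structure IsCoin {Ω : Type*} [MeasurableSpace Ω] (P : Measure Ω) {n b : ℕ}
    (I : ℕ → Ω → Fin b → Fin n) (m : ℕ) (c : ℕ → Ω → Bool) : Prop where
  measurable : ∀ k, Measurable (c k)
  prob : ∀ k, P {ω | c k ω = true} = (m : ℝ≥0∞)⁻¹
  indep : iIndepFun c P
  indep_batches : IndepFun (fun ω k => c k ω) (fun ω (p : ℕ × Fin b) => I p.1 ω p.2) P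

/-! ### The three algorithms, along one realization of the randomness -/

/-- `x'` minimizes `z ↦ (μ/2) ‖z - x‖² + ⟪g, z⟫ + u(z, x)`. -/
def IsMMStep {d : ℕ} (u : EucSp d → EucSp d → EReal) (μ : ℝ) (g x x' : EucSp d) : Prop :=
  ∀ z : EucSp d, ((μ / 2 * ‖x' - x‖ ^ 2 + inner ℝ g x' : ℝ) : EReal) + u x' x ≤
    ((μ / 2 * ‖z - x‖ ^ 2 + inner ℝ g z : ℝ) : EReal) + u z x

/-- The points of the SAGA table before iteration `k`: `sagaTable x I k i = x_i^{k-1}`. -/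
def sagaTable {n b d : ℕ} (x : ℕ → EucSp d) (I : ℕ → Fin b → Fin n) : ℕ → Fin n → EucSp d
  | 0, _ => x 0
  | k + 1, i => open Classical in if ∃ j, I k j = i then x k else sagaTable x I k i

/-- SAGA gradient estimate at iteration `k`. -/
noncomputable def sagaEst {n b d : ℕ} (f : Fin n → EucSp d → ℝ) (x : ℕ → EucSp d)
    (I : ℕ → Fin b → Fin n) (k : ℕ) : EucSp d :=
  (1 / (b : ℝ)) • ∑ j, (gradient (f (I k j)) (x k)
      - gradient (f (I k j)) (sagaTable x I k (I k j)))
    + (1 / (n : ℝ)) • ∑ i, gradient (f i) (sagaTable x I k i)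

/-- The iterates `x` are generated by MM-SAGA. -/
def IsMMSaga {n b d : ℕ} (f : Fin n → EucSp d → ℝ) (u : EucSp d → EucSp d → EReal) (μ : ℝ)
    (I : ℕ → Fin b → Fin n) (x : ℕ → EucSp d) : Prop :=
  ∀ k, IsMMStep u μ (sagaEst f x I k) (x k) (x (k + 1))

/-- The loop-less SVRG anchors `x̃^k` (with `x̃^{-1} = x^0`). -/
def svrgAnchor {d : ℕ} (x : ℕ → EucSp d) (c : ℕ → Bool) : ℕ → EucSp d
  | 0 => x 0
  | k + 1 => if c (k + 1) then x (k + 1) else svrgAnchor x c k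

/-- Loop-less SVRG gradient estimate at iteration `k`. -/
noncomputable def svrgEst {n b d : ℕ} (f : Fin n → EucSp d → ℝ) (x : ℕ → EucSp d)
    (I : ℕ → Fin b → Fin n) (c : ℕ → Bool) (k : ℕ) : EucSp d :=
  (1 / (b : ℝ)) • ∑ j, (gradient (f (I k j)) (x k) - gradient (f (I k j)) (svrgAnchor x c k))
    + avgGrad f (svrgAnchor x c k)

/-- The iterates `x` are generated by MM-SVRG. -/
def IsMMSvrg {n b d : ℕ} (f : Fin n → EucSp d → ℝ) (u : EucSp d → EucSp d → EReal) (μ : ℝ)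
    (I : ℕ → Fin b → Fin n) (c : ℕ → Bool) (x : ℕ → EucSp d) : Prop :=
  ∀ k, IsMMStep u μ (svrgEst f x I c k) (x k) (x (k + 1))

/-- Loop-less SARAH gradient estimate at iteration `k`. Since `x^{-1} = x^0` and the estimate at
`-1` is `∇f(x^0)`, both outcomes of the coin give `∇f(x^0)` at `k = 0`. -/
noncomputable def sarahEst {n b d : ℕ} (f : Fin n → EucSp d → ℝ) (x : ℕ → EucSp d)
    (I : ℕ → Fin b → Fin n) (c : ℕ → Bool) : ℕ → EucSp d
  | 0 => avgGrad f (x 0)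
  | k + 1 => if c (k + 1) then avgGrad f (x (k + 1)) else
      (1 / (b : ℝ)) • ∑ j, (gradient (f (I (k + 1) j)) (x (k + 1))
        - gradient (f (I (k + 1) j)) (x k)) + sarahEst f x I c k

/-- The iterates `x` are generated by MM-SARAH. -/
def IsMMSarah {n b d : ℕ} (f : Fin n → EucSp d → ℝ) (u : EucSp d → EucSp d → EReal) (μ : ℝ)
    (I : ℕ → Fin b → Fin n) (c : ℕ → Bool) (x : ℕ → EucSp d) : Prop :=
  ∀ k, IsMMStep u μ (sarahEst f x I c k) (x k) (x (k + 1))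

/-! ### Evaluations of component gradients `∇f_i` in the iterations `0, …, K - 1`

Each method also evaluates the `n` component gradients at `x^0` once, before iteration `0`; this
start-up cost is not part of the counts. -/

/-- MM-SAGA stores the table of gradients: an iteration evaluates `b` new ones. -/
def sagaCost (b K : ℕ) : ℕ := ∑ _k ∈ Finset.range K, b

/-- An iteration of MM-SVRG evaluates `2b` component gradients, and `n` more when the anchor
moves. -/
def svrgCost (n b : ℕ) (c : ℕ → Bool) (K : ℕ) : ℕ :=
  ∑ k ∈ Finset.range K, (2 * b + if c k then n else 0)

/-- An iteration of MM-SARAH evaluates `n` component gradients if it computes the full gradient,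
and `2b` otherwise. -/
def sarahCost (n b : ℕ) (c : ℕ → Bool) (K : ℕ) : ℕ :=
  ∑ k ∈ Finset.range K, if c k then n else 2 * b

/-- In expectation, one of `x^1, …, x^K` is an `ε`-stationary point of `F`:
`min_{1 ≤ k ≤ K} 𝔼 dist²(0, ∂F(x^k)) ≤ ε²` (the distance to the empty set is `∞`). -/
def ReachesStationary {Ω : Type*} [MeasurableSpace Ω] (P : Measure Ω) {d : ℕ}
    (F : EucSp d → EReal) (x : ℕ → Ω → EucSp d) (K : ℕ) (ε : ℝ) : Prop :=
  ∃ k, 1 ≤ k ∧ k ≤ K ∧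
    ∫⁻ ω, Metric.infEDist 0 (limitingSubdiff F (x k ω)) ^ 2 ∂P ≤ ENNReal.ofReal (ε ^ 2)

/-! ### The constants of the convergence condition and the parameter choices -/

/-- The left-hand side `(2μ - L)² - 4 (V + V_Υ / ρ)` of the convergence condition. -/
noncomputable def condLHS (μ L V VΥ ρ : ℝ) : ℝ := (2 * μ - L) ^ 2 - 4 * (V + VΥ / ρ)

/-- The convergence condition's left-hand side for MM-SAGA:
`V = 0`, `V_Υ = (2n - b) L² / b²`, `ρ = b / (2n)`. -/
noncomputable def sagaCond (μ L : ℝ) (n b : ℕ) : ℝ :=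
  condLHS μ L 0 ((2 * (n : ℝ) - b) * L ^ 2 / (b : ℝ) ^ 2) ((b : ℝ) / (2 * n))

/-- The same for MM-SVRG: `V = 0`, `V_Υ = (2m - 1) L² / b`, `ρ = 1 / (2m)`. -/
noncomputable def svrgCond (μ L : ℝ) (b m : ℕ) : ℝ :=
  condLHS μ L 0 ((2 * (m : ℝ) - 1) * L ^ 2 / b) (1 / (2 * (m : ℝ)))

/-- The same for MM-SARAH: `V = L² / b`, `V_Υ = (m - 1) L² / (m b)`, `ρ = 1 / m`. -/
noncomputable def sarahCond (μ L : ℝ) (b m : ℕ) : ℝ :=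
  condLHS μ L (L ^ 2 / b) (((m : ℝ) - 1) * L ^ 2 / ((m : ℝ) * b)) (1 / (m : ℝ))

/-- `b = ⌊4^{2/3} n^{2/3}⌋`. -/
noncomputable def sagaB (n : ℕ) : ℕ := ⌊(4 : ℝ) ^ (2 / 3 : ℝ) * (n : ℝ) ^ (2 / 3 : ℝ)⌋₊

/-- `b = ⌊n^{2/3}⌋`. -/
noncomputable def svrgB (n : ℕ) : ℕ := ⌊(n : ℝ) ^ (2 / 3 : ℝ)⌋₊

/-- `m = ⌊√b / 4⌋`. -/
noncomputable def svrgM (n : ℕ) : ℕ := ⌊√(svrgB n : ℝ) / 4⌋₊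

/-- `b = ⌊n^{1/2}⌋`. -/
noncomputable def sarahB (n : ℕ) : ℕ := ⌊(n : ℝ) ^ (1 / 2 : ℝ)⌋₊

/-- `m = ⌊b / 4⌋`. -/
noncomputable def sarahM (n : ℕ) : ℕ := ⌊(sarahB n : ℝ) / 4⌋₊

/-! ### Smooth functions -/

/-! Claim 1 is arithmetic: after clearing denominators, the floors enter through `16 n ^ 2 < (b + 1)
^ 3` and `b ^ 3 ≤ 16 n ^ 2` (SAGA), `16 m ^ 2 ≤ b` (SVRG) and `4 m ≤ b` (SARAH). The margin in the
condition, relative to `L ^ 2`, can be arbitrarily small, and it is zero for SARAH when `4 ∣ b`.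
Hence it yields no constant independent of `n`, and Claim 2 rests on sharper estimates that leave a
fixed margin.

Write `Δ` for the step, `e` for the full gradient minus its estimate. The subproblem is `L`-strongly
convex and `u` majorizes `r`, so the objective changes by at most `⟪e, Δ⟫ - L ‖Δ‖²` plus the
linearization error of `f` (`objVal_step_le`). The noise term is treated in two ways.

SAGA and SVRG are methods with a table of reference points and an estimate that is unbiased given
the past. The step depends on the estimate cocoercively; comparing with an independent copy of the
batch gives `𝔼⟪e, Δ⟫ ≤ 𝔼‖e‖² / L` without spending any of the quadratic decrease
(`integral_inner_le_of_symmetrization`). A contraction of the table gap bounds `∑ 𝔼‖e‖²` by `49/100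
* L ^ 2 * ∑ 𝔼‖Δ‖²`, while up to `1/2` would be affordable.

The SARAH estimate is biased, so Young's inequality is used, and by itself it leaves no margin. The
margin comes from the change `G` of the full gradient: the variance of a batch difference is a
second moment minus `G`, so a large `G` reduces the error (`errSq_succ_le`), whereas a small `G`
improves the descent inequality (`objVal_step_le_norm`). In the sum the two occurrences of `G`
cancel.

In all cases `∑ 𝔼‖Δ‖² ≤ 100 D / L` and `∑ 𝔼‖e‖² ≤ L ^ 2 / 2 * ∑ 𝔼‖Δ‖²`. Optimality of the step
bounds the distance from `0` to the subdifferential of `F` by `‖Δ‖` and `‖e‖` (`infEDist_sq_le`),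
and averaging over `K` of order `1 / ε ^ 2` iterations finishes the proof. Measurability of the
iterates comes for free: minimizers are unique, so each iterate is a function of finitely many draws
from finite sets. -/

theorem le_add_inner_add_sq_of_lipschitz_gradient {d : ℕ} {f : EucSp d → ℝ}
    {f' : EucSp d → EucSp d} {L : ℝ} (hf : ∀ x, HasGradientAt f (f' x) x)
    (hL : ∀ x y, ‖f' x - f' y‖ ≤ L * ‖x - y‖) (x y : EucSp d) :
    f y ≤ f x + inner ℝ (f' x) (y - x) + L / 2 * ‖y - x‖ ^ 2 := by
  set v := y - x with hv
  have hline : ∀ t : ℝ, HasDerivAt (fun t : ℝ => x + t • v) v t := fun t => by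
    simpa using ((hasDerivAt_id t).smul_const v).const_add x
  -- Along the segment, `f` minus the claimed quadratic upper model has nonpositive derivative on
  -- `[0, 1]`.
  have hder : ∀ t : ℝ, HasDerivAt
      (fun t : ℝ => f (x + t • v) - t * inner ℝ (f' x) v - L / 2 * t ^ 2 * ‖v‖ ^ 2)
      (inner ℝ (f' (x + t • v)) v - inner ℝ (f' x) v - L * t * ‖v‖ ^ 2) t := fun t => by
    have h1 : HasDerivAt (fun t : ℝ => f (x + t • v)) (inner ℝ (f' (x + t • v)) v) t := by
      have := (hf (x + t • v)).hasFDerivAt.comp_hasDerivAt t (hline t)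
      rwa [InnerProductSpace.toDual_apply_apply] at this
    have h2 : HasDerivAt (fun t : ℝ => t * inner ℝ (f' x) v) (inner ℝ (f' x) v) t := by
      simpa using (hasDerivAt_id t).mul_const (inner ℝ (f' x) v)
    have h3 : HasDerivAt (fun t : ℝ => L / 2 * t ^ 2 * ‖v‖ ^ 2) (L * t * ‖v‖ ^ 2) t := by
      exact (((hasDerivAt_pow 2 t).const_mul (L / 2)).mul_const (‖v‖ ^ 2)).congr_deriv
        (by push_cast; ring)
    exact (h1.sub h2).sub h3
  have hanti := antitoneOn_of_deriv_nonpos (convex_Icc (0 : ℝ) 1)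
    (fun t _ => (hder t).continuousAt.continuousWithinAt)
    (fun t _ => (hder t).differentiableAt.differentiableWithinAt) (fun t ht => by
      rw [interior_Icc] at ht
      rw [(hder t).deriv, ← inner_sub_left]
      have h1 := real_inner_le_norm (f' (x + t • v) - f' x) v
      have h2 := hL (x + t • v) x
      rw [add_sub_cancel_left, norm_smul, Real.norm_of_nonneg ht.1.le] at h2
      nlinarith [mul_le_mul_of_nonneg_right h2 (norm_nonneg v)])
  have := hanti (Set.left_mem_Icc.2 zero_le_one) (Set.right_mem_Icc.2 zero_le_one) zero_le_one
  have hy : x + v = y := by rw [hv]; abel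
  simp only [one_smul, zero_smul, hy, add_zero] at this
  linarith

theorem add_inner_le_add_sq_of_lipschitz_gradient {d : ℕ} {f : EucSp d → ℝ}
    {f' : EucSp d → EucSp d} {L : ℝ} (hf : ∀ x, HasGradientAt f (f' x) x)
    (hL : ∀ x y, ‖f' x - f' y‖ ≤ L * ‖x - y‖) (x y : EucSp d) :
    f x + inner ℝ (f' x) (y - x) ≤ f y + L / 2 * ‖y - x‖ ^ 2 := by
  have h := le_add_inner_add_sq_of_lipschitz_gradient (f := fun x => -f x) (f' := fun x => -f' x)
    (L := L) (fun x => by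
      have := (hf x).hasFDerivAt.neg
      rw [hasGradientAt_iff_hasFDerivAt, map_neg]
      exact this) (fun x y => by
      rw [← neg_sub', norm_neg]
      exact hL x y) x y
  rw [inner_neg_left] at h
  linarith

/-- A descent inequality which is better than the usual one when the gradients at the end points
are close to each other. -/
theorem le_add_inner_add_of_lipschitz_gradient_midpoint {d : ℕ} {f : EucSp d → ℝ}
    {f' : EucSp d → EucSp d} {L : ℝ} (hf : ∀ x, HasGradientAt f (f' x) x)
    (hL : ∀ x y, ‖f' x - f' y‖ ≤ L * ‖x - y‖) (x y : EucSp d) :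
    f y ≤ f x + inner ℝ (f' x) (y - x) + L / 4 * ‖y - x‖ ^ 2
      + 1 / 2 * inner ℝ (f' y - f' x) (y - x) := by
  -- The upper model based at `x` and the lower model based at `y` are compared at the midpoint;
  -- each costs only `L / 8 * ‖y - x‖ ^ 2`.
  set z := x + (1 / 2 : ℝ) • (y - x) with hz
  have h1 := le_add_inner_add_sq_of_lipschitz_gradient hf hL x z
  have h2 := add_inner_le_add_sq_of_lipschitz_gradient hf hL y z
  have e1 : z - x = (1 / 2 : ℝ) • (y - x) := by rw [hz]; abel
  have e2 : z - y = -((1 / 2 : ℝ) • (y - x)) := by rw [hz]; module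
  rw [e1, norm_smul, inner_smul_right] at h1
  rw [e2, norm_neg, norm_smul, inner_neg_right, inner_smul_right] at h2
  rw [inner_sub_left]
  norm_num at h1 h2
  nlinarith

/-! ### Regularity of the averaged function -/

theorem norm_avg_sq_le {n d : ℕ} (v : Fin n → EucSp d) :
    ‖(1 / (n : ℝ)) • ∑ i, v i‖ ^ 2 ≤ (1 / (n : ℝ)) * ∑ i, ‖v i‖ ^ 2 := by
  rcases Nat.eq_zero_or_pos n with rfl | hn
  · simp
  have hn' : (0 : ℝ) < n := by exact_mod_cast hn
  rw [norm_smul, mul_pow, Real.norm_of_nonneg (by positivity)]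
  have h1 : ‖∑ i, v i‖ ^ 2 ≤ n * ∑ i, ‖v i‖ ^ 2 := by
    calc ‖∑ i, v i‖ ^ 2 ≤ (∑ i, ‖v i‖) ^ 2 := by gcongr; exact norm_sum_le _ _
      _ ≤ _ := by simpa using sq_sum_le_card_mul_sum_sq (s := Finset.univ) (f := fun i => ‖v i‖)
  calc (1 / (n : ℝ)) ^ 2 * ‖∑ i, v i‖ ^ 2 ≤ (1 / (n : ℝ)) ^ 2 * (n * ∑ i, ‖v i‖ ^ 2) := by gcongr
    _ = _ := by field_simp

namespace BasicAssumption

variable {n d : ℕ} {f : Fin n → EucSp d → ℝ} {r : EucSp d → EReal} {L : ℝ}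

theorem hasGradientAt_avgFun (h : BasicAssumption f r L) (x : EucSp d) :
    HasGradientAt (avgFun f) (avgGrad f x) x := by
  rw [hasGradientAt_iff_hasFDerivAt]
  have h1 : ∀ i, HasFDerivAt (f i) (InnerProductSpace.toDual ℝ (EucSp d) (gradient (f i) x)) x :=
    fun i => ((h.contDiff i).differentiable (by norm_num) x).hasGradientAt.hasFDerivAt
  have h2 := (HasFDerivAt.fun_sum (u := Finset.univ) fun i _ => h1 i).const_mul (1 / (n : ℝ))
  have e : InnerProductSpace.toDual ℝ (EucSp d) (avgGrad f x) =
      (1 / (n : ℝ)) • ∑ i, InnerProductSpace.toDual ℝ (EucSp d) (gradient (f i) x) := by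
    unfold avgGrad
    rw [map_smul, map_sum]
  rw [e]
  exact h2

theorem avgGrad_sub (x y : EucSp d) : avgGrad f x - avgGrad f y =
    (1 / (n : ℝ)) • ∑ i, (gradient (f i) x - gradient (f i) y) := by
  simp [avgGrad, smul_sub]

theorem norm_avgGrad_sub_sq_le (h : BasicAssumption f r L) (x y : EucSp d) :
    ‖avgGrad f x - avgGrad f y‖ ^ 2 ≤ L ^ 2 * ‖x - y‖ ^ 2 := by
  rw [avgGrad_sub]
  exact (norm_avg_sq_le _).trans (h.avgSmooth x y)

theorem norm_avgGrad_sub_le (h : BasicAssumption f r L) (hL : 0 ≤ L) (x y : EucSp d) :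
    ‖avgGrad f x - avgGrad f y‖ ≤ L * ‖x - y‖ := by
  have := h.norm_avgGrad_sub_sq_le x y
  rw [← mul_pow] at this
  exact le_of_sq_le_sq this (by positivity)

theorem continuous_avgGrad (h : BasicAssumption f r L) (hL : 0 ≤ L) : Continuous (avgGrad f) :=
  (LipschitzWith.of_dist_le_mul (K := ⟨L, hL⟩) fun x y => by
    rw [dist_eq_norm, dist_eq_norm]
    exact h.norm_avgGrad_sub_le hL x y).continuous

end BasicAssumption

/-! ### Subdifferentials -/

theorem add_mem_frechetSubdiff {d : ℕ} {φ : EucSp d → ℝ} {r : EucSp d → EReal}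
    {x p v : EucSp d} (hφ : HasGradientAt φ p x) (hv : v ∈ frechetSubdiff r x) :
    p + v ∈ frechetSubdiff (fun z => (φ z : EReal) + r z) x := by
  refine ⟨EReal.add_ne_top (EReal.coe_ne_top _) hv.1, fun δ hδ => ?_⟩
  have h1 := (hasGradientAt_iff_isLittleO.1 hφ).bound (half_pos hδ)
  filter_upwards [h1, hv.2 (δ / 2) (half_pos hδ)] with y hy1 hy2
  have e1 : φ x + (inner ℝ p (y - x) - δ / 2 * ‖y - x‖) ≤ φ y := by
    have := (abs_le.1 hy1).1
    linarith
  have hr := add_le_add (EReal.coe_le_coe_iff.2 e1) hy2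
  refine le_of_eq_of_le ?_ hr
  rw [EReal.coe_add (φ x), add_add_add_comm, ← EReal.coe_add]
  congr 2
  rw [inner_add_left]
  ring

theorem add_mem_limitingSubdiff {d : ℕ} {φ : EucSp d → ℝ} {φ' : EucSp d → EucSp d}
    {r : EucSp d → EReal} {x v : EucSp d} (hφ : ∀ z, HasGradientAt φ (φ' z) z)
    (hφ' : Continuous φ') (hv : v ∈ limitingSubdiff r x) :
    φ' x + v ∈ limitingSubdiff (fun z => (φ z : EReal) + r z) x := by
  obtain ⟨hx, xs, vs, h1, h2, h3, h4⟩ := hv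
  refine ⟨EReal.add_ne_top (EReal.coe_ne_top _) hx, xs, fun j => φ' (xs j) + vs j, h1, ?_,
    fun j => add_mem_frechetSubdiff (hφ _) (h3 j), ((hφ'.tendsto x).comp h1).add h4⟩
  have hc : Tendsto (fun j => φ (xs j)) atTop (𝓝 (φ x)) :=
    ((hφ x).hasFDerivAt.continuousAt.tendsto).comp h1
  have hc' : Tendsto (fun j => (φ (xs j) : EReal)) atTop (𝓝 (φ x : EReal)) :=
    (continuous_coe_real_ereal.tendsto _).comp hc
  exact (EReal.continuousAt_add (p := ((φ x : EReal), r x)) (Or.inl (EReal.coe_ne_top _))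
    (Or.inl (EReal.coe_ne_bot _))).tendsto.comp (hc'.prodMk_nhds h2)

theorem frechetSubdiff_subset_limitingSubdiff {d : ℕ} (g : EucSp d → EReal) (x : EucSp d) :
    frechetSubdiff g x ⊆ limitingSubdiff g x := fun v hv =>
  ⟨hv.1, fun _ => x, fun _ => v, tendsto_const_nhds, tendsto_const_nhds, fun _ => hv,
    tendsto_const_nhds⟩

/-! ### One step of the algorithms -/

namespace IsMMStep

variable {d : ℕ} {u : EucSp d → EucSp d → EReal} {r : EucSp d → EReal} {μ : ℝ}
  {g x x' : EucSp d}

theorem surrogate_ne_top (h : IsMMStep u μ g x x') {z : EucSp d} (hz : u z x ≠ ⊤) :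
    u x' x ≠ ⊤ := by
  intro htop
  have := h z
  rw [htop, EReal.coe_add_top, top_le_iff] at this
  exact EReal.add_ne_top (EReal.coe_ne_top _) hz this

/-- First-order optimality. Expanding the square around `x'` leaves a remainder `μ / 2 * ‖y - x'‖ ^
2`, which is below `δ * ‖y - x'‖` near `x'`. -/
theorem mem_frechetSubdiff (h : IsMMStep u μ g x x') (htop : u x' x ≠ ⊤)
    (hbot : u x' x ≠ ⊥) :
    -(g + μ • (x' - x)) ∈ frechetSubdiff (fun z => u z x) x' := by
  refine ⟨htop, fun δ hδ => ?_⟩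
  have hev : ∀ᶠ y in 𝓝 x', μ / 2 * ‖y - x'‖ < δ := by
    have : Continuous fun y => μ / 2 * ‖y - x'‖ := by fun_prop
    exact (this.tendsto x').eventually_lt_const (by simpa using hδ)
  filter_upwards [hev] with y hy
  have h1 := h y
  obtain ⟨a, ha⟩ : ∃ a : ℝ, u x' x = a := ⟨_, (EReal.coe_toReal htop hbot).symm⟩
  simp only [ha] at h1 ⊢
  induction hb : u y x with
  | bot =>
    rw [hb, EReal.add_bot, ← EReal.coe_add] at h1
    exact absurd (le_bot_iff.1 h1) (EReal.coe_ne_bot _)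
  | top => exact le_top
  | coe b =>
    rw [hb] at h1
    norm_cast at h1 ⊢
    have e : ‖y - x‖ ^ 2 = ‖y - x'‖ ^ 2 + 2 * inner ℝ (y - x') (x' - x) + ‖x' - x‖ ^ 2 := by
      rw [← norm_add_sq_real]; congr 2; abel
    have e2 : inner ℝ g y = inner ℝ g (y - x') + inner ℝ g x' := by
      rw [← inner_add_right]; simp
    rw [inner_neg_left, inner_add_left, inner_smul_left]
    rw [e, e2, real_inner_comm (x' - x)] at h1
    simp only [conj_trivial]
    nlinarith [mul_le_mul_of_nonneg_right hy.le (norm_nonneg (y - x'))]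

/-- Quadratic growth at the minimizer: minimality is tested on the segment from `x'` to `z`,
convexity of `u(·, x)` is inserted, the inequality is divided by `t`, and `t → 0`. -/
theorem strong_min (h : IsMMStep u μ g x x') (hc : ExtConvex fun z => u z x) {z : EucSp d}
    {a b : ℝ} (ha : u z x = a) (hb : u x' x = b) :
    μ / 2 * ‖x' - x‖ ^ 2 + inner ℝ g x' + b + μ / 2 * ‖z - x'‖ ^ 2 ≤
      μ / 2 * ‖z - x‖ ^ 2 + inner ℝ g z + a := by
  have key : ∀ t : ℝ, 0 < t → t < 1 →
      μ / 2 * ‖x' - x‖ ^ 2 + inner ℝ g x' + b + (1 - t) * (μ / 2 * ‖z - x'‖ ^ 2) ≤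
      μ / 2 * ‖z - x‖ ^ 2 + inner ℝ g z + a := by
    intro t ht0 ht1
    have h1 := h ((1 - t) • x' + t • z)
    have h2 := hc x' z t ht0 ht1
    simp only [ha, hb] at h2
    have h3 := h1.trans (add_le_add le_rfl h2)
    rw [hb] at h3
    norm_cast at h3
    have e1 : (1 - t) • x' + t • z - x = (x' - x) + t • (z - x') := by module
    have e2 : inner ℝ g ((1 - t) • x' + t • z) = inner ℝ g x' + t * (inner ℝ g z - inner ℝ g x') := by
      rw [inner_add_right, inner_smul_right, inner_smul_right]; ring
    have e3 : z - x = (x' - x) + (z - x') := by abel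
    rw [e1, e2, norm_add_sq_real, norm_smul, inner_smul_right, Real.norm_of_nonneg ht0.le] at h3
    rw [e3, norm_add_sq_real]
    have : t * (μ / 2 * ‖x' - x‖ ^ 2 + inner ℝ g x' + b + (1 - t) * (μ / 2 * ‖z - x'‖ ^ 2)) ≤
      t * (μ / 2 * (‖x' - x‖ ^ 2 + 2 * inner ℝ (x' - x) (z - x') + ‖z - x'‖ ^ 2)
        + inner ℝ g z + a) := by nlinarith
    exact le_of_mul_le_mul_left this ht0
  have hlim : Tendsto (fun t : ℝ => μ / 2 * ‖x' - x‖ ^ 2 + inner ℝ g x' + b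
      + (1 - t) * (μ / 2 * ‖z - x'‖ ^ 2)) (𝓝[>] 0)
      (𝓝 (μ / 2 * ‖x' - x‖ ^ 2 + inner ℝ g x' + b + (1 - 0) * (μ / 2 * ‖z - x'‖ ^ 2))) := by
    refine Tendsto.mono_left (Continuous.tendsto ?_ 0) nhdsWithin_le_nhds
    fun_prop
  rw [sub_zero, one_mul] at hlim
  refine le_of_tendsto hlim ?_
  filter_upwards [Ioo_mem_nhdsGT (zero_lt_one' ℝ)] with t ht using key t ht.1 ht.2

/-- Two steps from the same point depend on the gradient estimate in a cocoercive way. -/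
theorem mul_norm_sub_sq_le {g₁ g₂ x₁ x₂ : EucSp d} (h₁ : IsMMStep u μ g₁ x x₁)
    (h₂ : IsMMStep u μ g₂ x x₂) (hc : ExtConvex fun z => u z x) (htop : u x x ≠ ⊤)
    (hbot : ∀ z, u z x ≠ ⊥) : μ * ‖x₁ - x₂‖ ^ 2 ≤ inner ℝ (g₂ - g₁) (x₁ - x₂) := by
  obtain ⟨a₁, ha₁⟩ : ∃ a : ℝ, u x₁ x = a :=
    ⟨_, (EReal.coe_toReal (h₁.surrogate_ne_top htop) (hbot _)).symm⟩
  obtain ⟨a₂, ha₂⟩ : ∃ a : ℝ, u x₂ x = a :=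
    ⟨_, (EReal.coe_toReal (h₂.surrogate_ne_top htop) (hbot _)).symm⟩
  -- Each minimizer is a competitor in the other problem; the values of `u` cancel in the sum of the
  -- two growth inequalities.
  have e₁ := h₁.strong_min hc ha₂ ha₁
  have e₂ := h₂.strong_min hc ha₁ ha₂
  rw [norm_sub_rev x₂ x₁] at e₁
  simp only [inner_sub_left, inner_sub_right]
  linarith

theorem unique {x₁ x₂ : EucSp d} (hμ : 0 < μ) (h₁ : IsMMStep u μ g x x₁)
    (h₂ : IsMMStep u μ g x x₂) (hc : ExtConvex fun z => u z x) (htop : u x x ≠ ⊤)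
    (hbot : ∀ z, u z x ≠ ⊥) : x₁ = x₂ := by
  have h := mul_norm_sub_sq_le h₁ h₂ hc htop hbot
  rw [sub_self, inner_zero_left] at h
  have : ‖x₁ - x₂‖ ^ 2 = 0 := le_antisymm (by nlinarith) (by positivity)
  exact sub_eq_zero.1 (norm_eq_zero.1 (pow_eq_zero_iff two_ne_zero |>.1 this))

/-- Cauchy–Schwarz turns `mul_norm_sub_sq_le` into `μ * ‖x₁ - x₂‖ ≤ ‖g₂ - g₁‖`, and a second
application gives the bound. This is the form that symmetrization needs. -/
theorem inner_sub_le {g₁ g₂ x₁ x₂ : EucSp d} (hμ : 0 < μ) (h₁ : IsMMStep u μ g₁ x x₁)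
    (h₂ : IsMMStep u μ g₂ x x₂) (hc : ExtConvex fun z => u z x) (htop : u x x ≠ ⊤)
    (hbot : ∀ z, u z x ≠ ⊥) : inner ℝ (g₂ - g₁) (x₁ - x₂) ≤ ‖g₂ - g₁‖ ^ 2 / μ := by
  have h := mul_norm_sub_sq_le h₁ h₂ hc htop hbot
  have h' := real_inner_le_norm (g₂ - g₁) (x₁ - x₂)
  rw [le_div_iff₀ hμ]
  nlinarith [sq_nonneg (‖g₂ - g₁‖ - μ * ‖x₁ - x₂‖), sq_nonneg (μ * ‖x₁ - x₂‖),
    norm_nonneg (x₁ - x₂), norm_nonneg (g₂ - g₁)]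

end IsMMStep

/-! ### Independence of finite-valued random variables -/

section Independence

variable {Ω : Type*} [MeasurableSpace Ω] {P : Measure Ω} [IsProbabilityMeasure P]

/-- Separates the current draw `A` from a past composed of draws of its own kind, `B`, and draws of
the other kind, `C`. -/
theorem IndepFun.prodMk_assoc {α β γ : Type*} [MeasurableSpace α] [MeasurableSpace β]
    [MeasurableSpace γ] {A : Ω → α} {B : Ω → β} {C : Ω → γ} (hA : Measurable A)
    (hB : Measurable B) (hC : Measurable C) (h₁ : IndepFun A B P)
    (h₂ : IndepFun (fun ω => (A ω, B ω)) C P) : IndepFun A (fun ω => (B ω, C ω)) P := by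
  have hBC : IndepFun B C P := h₂.comp measurable_snd measurable_id
  rw [indepFun_iff_map_prod_eq_prod_map_map hA.aemeasurable (hB.prodMk hC).aemeasurable,
    hBC.map_prod_eq_prod_map_map hB.aemeasurable hC.aemeasurable]
  have e : (fun ω => (A ω, (B ω, C ω))) =
      MeasurableEquiv.prodAssoc ∘ fun ω => ((A ω, B ω), C ω) := rfl
  have : IsProbabilityMeasure (P.map A) := Measure.isProbabilityMeasure_map hA.aemeasurable
  have : IsProbabilityMeasure (P.map B) := Measure.isProbabilityMeasure_map hB.aemeasurable
  have : IsProbabilityMeasure (P.map C) := Measure.isProbabilityMeasure_map hC.aemeasurable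
  rw [e, ← Measure.map_map (MeasurableEquiv.measurable _) ((hA.prodMk hB).prodMk hC),
    h₂.map_prod_eq_prod_map_map (hA.prodMk hB).aemeasurable hC.aemeasurable,
    h₁.map_prod_eq_prod_map_map hA.aemeasurable hB.aemeasurable]
  exact Measure.prodAssoc_prod

variable {α β E : Type*} [Finite α] [Finite β] [MeasurableSpace α] [MeasurableSpace β]
  [DiscreteMeasurableSpace α] [DiscreteMeasurableSpace β] {A : Ω → α} {B : Ω → β}
  [NormedAddCommGroup E] [NormedSpace ℝ E]

omit [IsProbabilityMeasure P] [Finite β] [MeasurableSpace β] [DiscreteMeasurableSpace β]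
  [NormedSpace ℝ E] in
theorem integrable_comp_of_finite [IsFiniteMeasure P] (hA : Measurable A) (φ : α → E) :
    Integrable (fun ω => φ (A ω)) P :=
  (Integrable.of_finite (μ := P.map A) (f := φ)).comp_measurable hA

/-- Fubini for the product law; on finite discrete spaces every `φ` is measurable and integrable. -/
theorem integral_comp_of_indepFun (hA : Measurable A) (hB : Measurable B) (h : IndepFun A B P)
    (φ : α → β → E) : ∫ ω, φ (A ω) (B ω) ∂P = ∫ ω, ∫ ω', φ (A ω) (B ω') ∂P ∂P := by
  have h1 := integral_map (μ := P) (hA.prodMk hB).aemeasurable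
    (f := fun z : α × β => φ z.1 z.2) (StronglyMeasurable.of_discrete).aestronglyMeasurable
  have : IsProbabilityMeasure (P.map A) := Measure.isProbabilityMeasure_map hA.aemeasurable
  have : IsProbabilityMeasure (P.map B) := Measure.isProbabilityMeasure_map hB.aemeasurable
  rw [h.map_prod_eq_prod_map_map hA.aemeasurable hB.aemeasurable,
    integral_prod _ Integrable.of_finite] at h1
  rw [← h1, integral_map hA.aemeasurable (StronglyMeasurable.of_discrete).aestronglyMeasurable]
  refine integral_congr_ae (.of_forall fun ω => ?_)
  exact integral_map hB.aemeasurable (StronglyMeasurable.of_discrete).aestronglyMeasurable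

/-- A relation known only for pairs that actually occur at one `ω` passes to almost all pairs of
independent values. This is needed because a run is given only along realizations, whereas an
independent copy recombines a past with another batch. -/
theorem ae_ae_of_indepFun (hA : Measurable A) (hB : Measurable B) (h : IndepFun A B P)
    {R : α → β → Prop} (hR : ∀ ω, R (A ω) (B ω)) : ∀ᵐ ω ∂P, ∀ᵐ ω' ∂P, R (A ω) (B ω') := by
  have h1 : ∀ᵐ z ∂(P.map fun ω => (A ω, B ω)), R z.1 z.2 :=
    (ae_map_iff (hA.prodMk hB).aemeasurable (MeasurableSet.of_discrete)).2 (.of_forall hR)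
  have : IsProbabilityMeasure (P.map A) := Measure.isProbabilityMeasure_map hA.aemeasurable
  have : IsProbabilityMeasure (P.map B) := Measure.isProbabilityMeasure_map hB.aemeasurable
  rw [h.map_prod_eq_prod_map_map hA.aemeasurable hB.aemeasurable] at h1
  filter_upwards [ae_of_ae_map hA.aemeasurable (Measure.ae_ae_of_ae_prod h1)] with ω hω
  exact ae_of_ae_map hB.aemeasurable hω

/-- The expected inner product of a centred random vector with another one, both of them
functions of the same randomness, under a cocoercivity bound. -/
theorem integral_inner_le_of_symmetrization {d : ℕ} {κ : ℝ} (hB : Measurable B)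
    (e X : β → EucSp d) (he : ∫ ω, e (B ω) ∂P = 0)
    (h : ∀ᵐ ω ∂P, ∀ᵐ ω' ∂P, inner ℝ (e (B ω) - e (B ω')) (X (B ω) - X (B ω'))
      ≤ κ * ‖e (B ω) - e (B ω')‖ ^ 2) :
    ∫ ω, inner ℝ (e (B ω)) (X (B ω)) ∂P ≤ κ * ∫ ω, ‖e (B ω)‖ ^ 2 ∂P := by
  have hint : ∀ φ : β → ℝ, Integrable (fun ω => φ (B ω)) P := integrable_comp_of_finite hB
  have hintE : ∀ φ : β → EucSp d, Integrable (fun ω => φ (B ω)) P := integrable_comp_of_finite hB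
  have hinner : ∀ v : EucSp d, ∫ ω, inner ℝ v (e (B ω)) ∂P = 0 := fun v => by
    rw [integral_inner (hintE e), he, inner_zero_right]
  set c := ∫ ω, inner ℝ (e (B ω)) (X (B ω)) ∂P with hc
  set s := ∫ ω, ‖e (B ω)‖ ^ 2 ∂P with hs
  set Xm := ∫ ω, X (B ω) ∂P with hXm
  -- The copy `ω'` is integrated out first; terms linear in the centred `e (B ω')` vanish.
  -- Integrating over `ω` then gives `2 * c ≤ κ * (2 * s)`.
  have key : ∀ᵐ ω ∂P, inner ℝ (e (B ω)) (X (B ω)) - inner ℝ Xm (e (B ω)) + c ≤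
      κ * (‖e (B ω)‖ ^ 2 + s) := by
    filter_upwards [h] with ω hω
    have h1 : ∀ᵐ ω' ∂P, inner ℝ (e (B ω)) (X (B ω)) - inner ℝ (e (B ω)) (X (B ω'))
        - inner ℝ (X (B ω)) (e (B ω')) + inner ℝ (e (B ω')) (X (B ω')) ≤
        κ * (‖e (B ω)‖ ^ 2 - 2 * inner ℝ (e (B ω)) (e (B ω')) + ‖e (B ω')‖ ^ 2) := by
      filter_upwards [hω] with ω' h'
      rw [norm_sub_sq_real] at h'
      simp only [inner_sub_left, inner_sub_right] at h'
      rw [real_inner_comm (e (B ω')) (X (B ω))]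
      linarith
    have h2 := integral_mono_ae (hint fun z => inner ℝ (e (B ω)) (X (B ω))
        - inner ℝ (e (B ω)) (X z) - inner ℝ (X (B ω)) (e z) + inner ℝ (e z) (X z))
      (hint fun z => κ * (‖e (B ω)‖ ^ 2 - 2 * inner ℝ (e (B ω)) (e z) + ‖e z‖ ^ 2)) h1
    rw [integral_add (hint fun z => inner ℝ (e (B ω)) (X (B ω)) - inner ℝ (e (B ω)) (X z)
        - inner ℝ (X (B ω)) (e z)) (hint fun z => inner ℝ (e z) (X z)),
      integral_sub (hint fun z => inner ℝ (e (B ω)) (X (B ω)) - inner ℝ (e (B ω)) (X z))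
        (hint fun z => inner ℝ (X (B ω)) (e z)),
      integral_sub (integrable_const _) (hint fun z => inner ℝ (e (B ω)) (X z)),
      integral_const_mul,
      integral_add (hint fun z => ‖e (B ω)‖ ^ 2 - 2 * inner ℝ (e (B ω)) (e z))
        (hint fun z => ‖e z‖ ^ 2),
      integral_sub (integrable_const _) (hint fun z => 2 * inner ℝ (e (B ω)) (e z)),
      integral_const_mul, hinner, hinner, integral_inner (hintE X)] at h2
    simp only [integral_const, probReal_univ, one_smul] at h2
    rw [← hc, ← hs, ← hXm] at h2
    linarith [real_inner_comm Xm (e (B ω))]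
  have h3 := integral_mono_ae (hint fun z => inner ℝ (e z) (X z) - inner ℝ Xm (e z) + c)
    (hint fun z => κ * (‖e z‖ ^ 2 + s)) key
  rw [integral_add (hint fun z => inner ℝ (e z) (X z) - inner ℝ Xm (e z)) (integrable_const _),
    integral_sub (hint fun z => inner ℝ (e z) (X z)) (hint fun z => inner ℝ Xm (e z)), hinner,
    integral_const_mul, integral_add (hint fun z => ‖e z‖ ^ 2) (integrable_const _)] at h3
  simp only [integral_const, probReal_univ, one_smul] at h3
  linarith

end Independence

/-! ### Random batches and coins -/

section Sampling

variable {Ω : Type*} [MeasurableSpace Ω] {P : Measure Ω} [IsProbabilityMeasure P] {n b d : ℕ}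
  {I : ℕ → Ω → Fin b → Fin n}

namespace IsSampling

omit [IsProbabilityMeasure P] in
theorem measurable_batch (hI : IsSampling P I) (k : ℕ) : Measurable (I k) :=
  measurable_pi_lambda _ fun j => hI.measurable k j

theorem integral_single (hI : IsSampling P I) {E : Type*} [NormedAddCommGroup E]
    [NormedSpace ℝ E] [CompleteSpace E] (k : ℕ) (j : Fin b) (φ : Fin n → E) :
    ∫ ω, φ (I k ω j) ∂P = (1 / (n : ℝ)) • ∑ i, φ i := by
  rw [← integral_map (μ := P) (hI.measurable k j).aemeasurable
    (StronglyMeasurable.of_discrete (f := φ)).aestronglyMeasurable]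
  have : IsProbabilityMeasure (P.map fun ω => I k ω j) :=
    Measure.isProbabilityMeasure_map (hI.measurable k j).aemeasurable
  rw [integral_fintype Integrable.of_finite, Finset.smul_sum]
  refine Finset.sum_congr rfl fun i _ => ?_
  rw [measureReal_def, Measure.map_apply (hI.measurable k j) (measurableSet_singleton i)]
  have := hI.uniform k j i
  change P ((fun ω => I k ω j) ⁻¹' {i}) = _ at this
  rw [this]
  simp

theorem integral_sum_eq_zero (hI : IsSampling P I) (k : ℕ) {w : Fin n → EucSp d}
    (hw : ∑ i, w i = 0) : ∫ ω, ∑ j, w (I k ω j) ∂P = 0 := by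
  rw [integral_finsetSum _ fun j _ => integrable_comp_of_finite (hI.measurable k j) w]
  simp [hI.integral_single k, hw]

/-- Distinct positions of a batch are independent and centred, so only the `b` diagonal terms of the
double sum survive. This is the source of the variance factor `1 / b`. -/
theorem integral_norm_sum_sq (hI : IsSampling P I) (k : ℕ) {w : Fin n → EucSp d}
    (hw : ∑ i, w i = 0) :
    ∫ ω, ‖∑ j, w (I k ω j)‖ ^ 2 ∂P = b * ((1 / (n : ℝ)) * ∑ i, ‖w i‖ ^ 2) := by
  have hexp : ∀ ω, ‖∑ j, w (I k ω j)‖ ^ 2 = ∑ j, ∑ l, inner ℝ (w (I k ω j)) (w (I k ω l)) :=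
    fun ω => by rw [← real_inner_self_eq_norm_sq, sum_inner]; simp only [inner_sum]
  have hint : ∀ j l, Integrable (fun ω => inner ℝ (w (I k ω j)) (w (I k ω l))) P := fun j l =>
    integrable_comp_of_finite (hI.measurable_batch k)
      fun β : Fin b → Fin n => (inner ℝ (w (β j)) (w (β l)) : ℝ)
  simp only [hexp]
  rw [integral_finsetSum _ fun j _ => integrable_finsetSum _ fun l _ => hint j l]
  have hval : ∀ j l, ∫ ω, inner ℝ (w (I k ω j)) (w (I k ω l)) ∂P =
      if j = l then (1 / (n : ℝ)) * ∑ i, ‖w i‖ ^ 2 else 0 := by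
    intro j l
    split_ifs with hjl
    · subst hjl
      simp only [real_inner_self_eq_norm_sq]
      exact hI.integral_single k j fun i => ‖w i‖ ^ 2
    · have hind : IndepFun (fun ω => I k ω j) (fun ω => I k ω l) P :=
        hI.indep.indepFun (i := (k, j)) (j := (k, l)) (by simpa using hjl)
      rw [integral_comp_of_indepFun (hI.measurable k j) (hI.measurable k l) hind
        fun i i' => (inner ℝ (w i) (w i') : ℝ)]
      refine integral_eq_zero_of_ae (.of_forall fun ω => ?_)
      change ∫ ω', inner ℝ (w (I k ω j)) (w (I k ω' l)) ∂P = 0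
      rw [integral_inner (integrable_comp_of_finite (hI.measurable k l) w), hI.integral_single, hw,
        smul_zero, inner_zero_right]
  simp only [integral_finsetSum _ fun l _ => hint _ l, hval]
  simp

/-- Bias-variance decomposition of a batch average of centred vectors plus a constant. -/
theorem integral_norm_add_avg_sq (hI : IsSampling P I) (hb : 0 < b) (k : ℕ) (e : EucSp d)
    {w : Fin n → EucSp d} (hw : ∑ i, w i = 0) :
    ∫ ω, ‖e + (1 / (b : ℝ)) • ∑ j, w (I k ω j)‖ ^ 2 ∂P =
      ‖e‖ ^ 2 + 1 / (b : ℝ) * ((1 / (n : ℝ)) * ∑ i, ‖w i‖ ^ 2) := by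
  have hb' : (b : ℝ) ≠ 0 := by exact_mod_cast hb.ne'
  have hi : ∀ φ : (Fin b → Fin n) → ℝ, Integrable (fun ω => φ (I k ω)) P :=
    integrable_comp_of_finite (hI.measurable_batch k)
  have hiE : Integrable (fun ω => ∑ j, w (I k ω j)) P :=
    integrable_comp_of_finite (hI.measurable_batch k) fun β => ∑ j, w (β j)
  simp only [norm_add_sq_real, norm_smul, inner_smul_right, mul_pow]
  rw [integral_add (hi fun β => ‖e‖ ^ 2 + 2 * (1 / (b : ℝ) * inner ℝ e (∑ j, w (β j))))
      (hi fun β => ‖1 / (b : ℝ)‖ ^ 2 * ‖∑ j, w (β j)‖ ^ 2),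
    integral_add (integrable_const _)
      (hi fun β => 2 * (1 / (b : ℝ) * inner ℝ e (∑ j, w (β j)))),
    integral_const_mul, integral_const_mul, integral_const_mul, integral_inner hiE,
    hI.integral_sum_eq_zero k hw, hI.integral_norm_sum_sq k hw]
  simp
  field_simp

theorem measureReal_notMem_batch (hI : IsSampling P I) (k : ℕ) (i : Fin n) :
    P.real {ω | ¬∃ j, I k ω j = i} = (1 - 1 / (n : ℝ)) ^ b := by
  have h1 : {ω | ¬∃ j, I k ω j = i} =
      ⋂ j ∈ (Finset.univ : Finset (Fin b)), (fun ω => I k ω j) ⁻¹' {i}ᶜ := by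
    ext ω; simp
  have h2 := (hI.indep.precomp (g := fun j : Fin b => (k, j))
    (fun _ _ h => (Prod.ext_iff.1 h).2)).measure_inter_preimage_eq_mul Finset.univ
    (sets := fun _ => {i}ᶜ) (fun _ _ => MeasurableSet.of_discrete)
  have h3 : ∀ j, P.real ((fun ω => I k ω j) ⁻¹' {i}ᶜ) = 1 - 1 / (n : ℝ) := fun j => by
    rw [Set.preimage_compl, probReal_compl_eq_one_sub (hI.measurable k j MeasurableSet.of_discrete),
      measureReal_def]
    have := hI.uniform k j i
    change P ((fun ω => I k ω j) ⁻¹' {i}) = _ at this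
    rw [this]
    simp
  rw [h1, measureReal_def, h2, ENNReal.toReal_prod]
  simp only [← measureReal_def, h3]
  simp

end IsSampling

/-- The first `p` batches and the first `q` coins. -/
def history (I : ℕ → Ω → Fin b → Fin n) (c : ℕ → Ω → Bool) (p q : ℕ) (ω : Ω) :
    (Fin p → Fin b → Fin n) × (Fin q → Bool) :=
  (fun j => I j ω, fun j => c j ω)

variable {c : ℕ → Ω → Bool} {m : ℕ}

namespace IsCoin

omit [IsProbabilityMeasure P] in
theorem measurable_history (hI : IsSampling P I) (hc : IsCoin P I m c) (p q : ℕ) :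
    Measurable (history I c p q) :=
  (measurable_pi_lambda (fun ω (j : Fin p) => I j ω) fun j => hI.measurable_batch j).prodMk
    (measurable_pi_lambda (fun ω (j : Fin q) => c j ω) fun j => hc.measurable j)

/-- Only the number of batches is restricted: the coins may run past time `k`, since the whole coin
sequence is independent of the batches. This allows the coin of an iteration to be fixed before its
batch is averaged. -/
theorem indepFun_history_batch (hI : IsSampling P I) (hc : IsCoin P I m c) {p k : ℕ}
    (hpk : p ≤ k) (q : ℕ) : IndepFun (history I c p q) (I k) P := by
  have h1 : IndepFun (I k) (fun ω (j : Fin p) => I j ω) P := by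
    have hd : Disjoint (({k} : Finset ℕ) ×ˢ (Finset.univ : Finset (Fin b)))
        (Finset.range p ×ˢ (Finset.univ : Finset (Fin b))) := by
      rw [Finset.disjoint_left]
      rintro ⟨x, y⟩ h h'
      simp only [Finset.mem_product, Finset.mem_singleton, Finset.mem_univ, and_true,
        Finset.mem_range] at h h'
      omega
    have h2 := hI.indep.indepFun_finset _ _ hd fun i => hI.measurable i.1 i.2
    exact h2.comp (φ := fun v (l : Fin b) => v ⟨(k, l), by simp⟩)
      (ψ := fun v (j : Fin p) (l : Fin b) => v ⟨(j, l), by simp⟩)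
      (Measurable.of_discrete) (Measurable.of_discrete)
  have h2 : IndepFun (fun ω => (I k ω, fun (j : Fin p) => I j ω)) (fun ω (j : Fin q) => c j ω) P :=
    (hc.indep_batches.comp
      (φ := fun (v : ℕ → Bool) (j : Fin q) => v j)
      (ψ := fun (v : ℕ × Fin b → Fin n) => ((fun l => v (k, l) : Fin b → Fin n),
        (fun j l => v (j, l) : Fin p → Fin b → Fin n)))
      (by fun_prop) (by fun_prop)).symm
  exact (IndepFun.prodMk_assoc (hI.measurable_batch k)
    (measurable_pi_lambda (fun ω (j : Fin p) => I j ω) fun j => hI.measurable_batch j)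
    (measurable_pi_lambda (fun ω (j : Fin q) => c j ω) fun j => hc.measurable j) h1 h2).symm

theorem indepFun_history_coin (hI : IsSampling P I) (hc : IsCoin P I m c) (p : ℕ) {q k : ℕ}
    (hqk : q ≤ k) : IndepFun (history I c p q) (c k) P := by
  have h1 : IndepFun (c k) (fun ω (j : Fin q) => c j ω) P := by
    have hd : Disjoint ({k} : Finset ℕ) (Finset.range q) := by
      rw [Finset.disjoint_singleton_left, Finset.mem_range]; omega
    have h2 := hc.indep.indepFun_finset _ _ hd hc.measurable
    exact h2.comp (φ := fun v => v ⟨k, by simp⟩)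
      (ψ := fun v (j : Fin q) => v ⟨j, by simp⟩)
      (Measurable.of_discrete) (Measurable.of_discrete)
  have h2 : IndepFun (fun ω => (c k ω, fun (j : Fin q) => c j ω)) (fun ω (j : Fin p) => I j ω) P :=
    hc.indep_batches.comp
      (φ := fun (v : ℕ → Bool) => (v k, fun (j : Fin q) => v j))
      (ψ := fun (v : ℕ × Fin b → Fin n) => (fun j l => v (j, l) : Fin p → Fin b → Fin n))
      (by fun_prop) (by fun_prop)
  have h3 := IndepFun.prodMk_assoc (hc.measurable k)
    (measurable_pi_lambda (fun ω (j : Fin q) => c j ω) fun j => hc.measurable j)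
    (measurable_pi_lambda (fun ω (j : Fin p) => I j ω) fun j => hI.measurable_batch j) h1 h2
  exact (h3.comp measurable_id measurable_swap).symm

theorem integral_coin (hc : IsCoin P I m c) (k : ℕ) (φ : Bool → ℝ) :
    ∫ ω, φ (c k ω) ∂P = 1 / (m : ℝ) * φ true + (1 - 1 / (m : ℝ)) * φ false := by
  have h1 : P.real (c k ⁻¹' {true}) = 1 / (m : ℝ) := by
    have := hc.prob k
    change P (c k ⁻¹' {true}) = _ at this
    rw [measureReal_def, this]
    simp
  have h2 : P.real (c k ⁻¹' {false}) = 1 - 1 / (m : ℝ) := by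
    rw [← h1, ← probReal_compl_eq_one_sub (hc.measurable k (measurableSet_singleton _))]
    congr 1
    ext ω
    simp
  rw [← integral_map (μ := P) (hc.measurable k).aemeasurable
    (StronglyMeasurable.of_discrete (f := φ)).aestronglyMeasurable]
  have : IsProbabilityMeasure (P.map (c k)) :=
    Measure.isProbabilityMeasure_map (hc.measurable k).aemeasurable
  rw [integral_fintype Integrable.of_finite]
  simp [map_measureReal_apply (hc.measurable k) (measurableSet_singleton _), h1, h2]

theorem lintegral_coin (hc : IsCoin P I m c) (k : ℕ) (s t : ℝ≥0∞) :
    ∫⁻ ω, (if c k ω then s else t) ∂P ≤ s * (m : ℝ≥0∞)⁻¹ + t := by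
  have h1 : MeasurableSet {ω | c k ω = true} := hc.measurable k (measurableSet_singleton true)
  calc ∫⁻ ω, (if c k ω then s else t) ∂P
      ≤ ∫⁻ ω, ({ω | c k ω = true}.indicator (fun _ => s) ω + t) ∂P := by
        refine lintegral_mono fun ω => ?_
        by_cases h : c k ω = true <;> simp [h]
    _ = _ := by
        rw [lintegral_add_right _ measurable_const, lintegral_indicator_const h1, hc.prob]
        simp

/-- A coin which always shows `true`. -/
theorem const_true (I : ℕ → Ω → Fin b → Fin n) : IsCoin P I 1 fun _ _ => true where
  measurable _ := measurable_const
  prob _ := by simp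
  indep := by
    rw [iIndepFun_iff_measure_inter_preimage_eq_mul]
    intro S sets _
    by_cases h : ∀ i ∈ S, true ∈ sets i
    · have h1 : ∀ i ∈ S, (fun _ : Ω => true) ⁻¹' sets i = Set.univ := fun i hi => by
        simp [h i hi]
      rw [Set.iInter₂_congr h1, Finset.prod_congr rfl fun i hi => by rw [h1 i hi]]
      simp
    · push Not at h
      obtain ⟨i, hi, hi'⟩ := h
      have h1 : (fun _ : Ω => true) ⁻¹' sets i = ∅ := by simp [hi']
      rw [Finset.prod_eq_zero hi (by rw [h1, measure_empty])]
      refine measure_mono_null (Set.iInter₂_subset i hi) (by rw [h1, measure_empty])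
  indep_batches := indepFun_const_left _ _

end IsCoin

end Sampling

/-! ### Progress and stationarity along one step -/

/-- The value of the objective as a real number, at points where it is finite. -/
noncomputable def objVal {n d : ℕ} (f : Fin n → EucSp d → ℝ) (r : EucSp d → EReal)
    (x : EucSp d) : ℝ :=
  avgFun f x + (r x).toReal

namespace ProblemAssumption

variable {n d : ℕ} {f : Fin n → EucSp d → ℝ} {r : EucSp d → EReal}
  {u : EucSp d → EucSp d → EReal} {S : Set (EucSp d)} {x0 : EucSp d} {L Lu D : ℝ}

theorem reg_x0_ne_top (h : ProblemAssumption f r u S x0 L Lu D) : r x0 ≠ ⊤ := by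
  intro htop
  obtain ⟨z, hz⟩ := h.basic.proper
  have h1 : objective f r x0 = ⊤ := by
    unfold objective
    rw [htop, EReal.coe_add_top]
  -- Properness makes the infimum differ from `⊤`, so the gap assumption forces a finite value at
  -- `x0`.
  have h2 : (⨅ x, objective f r x) ≠ ⊤ := fun hi => by
    have h3 := iInf_le (objective f r) z
    rw [hi, top_le_iff] at h3
    exact EReal.add_ne_top (EReal.coe_ne_top _) hz h3
  have h4 := h.gap
  rw [h1, top_le_iff] at h4
  exact EReal.add_ne_top h2 (EReal.coe_ne_top _) h4

theorem objective_eq (h : ProblemAssumption f r u S x0 L Lu D) {y : EucSp d} (hy : r y ≠ ⊤) :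
    objective f r y = (objVal f r y : EReal) := by
  rw [objective, objVal, EReal.coe_add, EReal.coe_toReal hy (h.basic.ne_bot y)]

theorem objVal_x0_le (h : ProblemAssumption f r u S x0 L Lu D) {y : EucSp d} (hy : r y ≠ ⊤) :
    objVal f r x0 ≤ objVal f r y + D := by
  have h1 := h.gap.trans (add_le_add (iInf_le (objective f r) y) le_rfl)
  rw [h.objective_eq h.reg_x0_ne_top, h.objective_eq hy] at h1
  exact_mod_cast h1

theorem surrogate_ne_bot (h : ProblemAssumption f r u S x0 L Lu D) (x y : EucSp d) :
    u x y ≠ ⊥ := fun hb => by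
  have := h.surrogate.majorant x y
  rw [hb, le_bot_iff] at this
  exact h.basic.ne_bot x this

theorem surrogate_self_ne_top (h : ProblemAssumption f r u S x0 L Lu D) {x : EucSp d}
    (hx : r x ≠ ⊤) : u x x ≠ ⊤ := by
  rwa [h.surrogate.tangent]

variable {g x x' : EucSp d}

theorem reg_step_ne_top (h : ProblemAssumption f r u S x0 L Lu D) (hx : r x ≠ ⊤)
    (hs : IsMMStep u L g x x') : r x' ≠ ⊤ := fun htop => by
  have h1 := h.surrogate.majorant x' x
  rw [htop, top_le_iff] at h1
  exact hs.surrogate_ne_top (h.surrogate_self_ne_top hx) h1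

theorem reg_ne_top (h : ProblemAssumption f r u S x0 L Lu D) {x g : ℕ → EucSp d}
    (h0 : x 0 = x0) (hs : ∀ k, IsMMStep u L (g k) (x k) (x (k + 1))) (k : ℕ) : r (x k) ≠ ⊤ := by
  induction k with
  | zero => rw [h0]; exact h.reg_x0_ne_top
  | succ k ih => exact h.reg_step_ne_top ih (hs k)

/-- Quadratic growth of the subproblem is applied with competitor `x`, where `u x x = r x`, and `r
x' ≤ u x' x` is used at the new point. The growth term doubles the coefficient `L / 2` to `L`. -/
theorem objVal_step_le (h : ProblemAssumption f r u S x0 L Lu D) (hx : r x ≠ ⊤)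
    (hs : IsMMStep u L g x x') :
    objVal f r x' ≤ objVal f r x + inner ℝ (avgGrad f x - g) (x' - x) - L * ‖x' - x‖ ^ 2
      + (avgFun f x' - avgFun f x - inner ℝ (avgGrad f x) (x' - x)) := by
  have hu := hs.surrogate_ne_top (h.surrogate_self_ne_top hx)
  have hb : u x' x = ((u x' x).toReal : EReal) :=
    (EReal.coe_toReal hu (h.surrogate_ne_bot _ _)).symm
  have ha : u x x = ((r x).toReal : EReal) := by
    rw [h.surrogate.tangent, EReal.coe_toReal hx (h.basic.ne_bot x)]
  have h1 := hs.strong_min (h.surrogateReg.convex_fst x) ha hb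
  have h2 : (r x').toReal ≤ (u x' x).toReal :=
    EReal.toReal_le_toReal (h.surrogate.majorant _ _) (h.basic.ne_bot _) hu
  rw [norm_sub_rev x x', sub_self, norm_zero] at h1
  have h3 : inner ℝ g (x' - x) = inner ℝ g x' - inner ℝ g x := inner_sub_right _ _ _
  rw [objVal, objVal, inner_sub_left]
  linarith

theorem objVal_step_le_inner (h : ProblemAssumption f r u S x0 L Lu D) (hL : 0 ≤ L)
    (hx : r x ≠ ⊤) (hs : IsMMStep u L g x x') :
    objVal f r x' ≤ objVal f r x + inner ℝ (avgGrad f x - g) (x' - x)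
      - L / 2 * ‖x' - x‖ ^ 2 := by
  have h1 := h.objVal_step_le hx hs
  have h2 := le_add_inner_add_sq_of_lipschitz_gradient h.basic.hasGradientAt_avgFun
    (h.basic.norm_avgGrad_sub_le hL) x x'
  linarith

/-- The linearization error is bounded by the mean of the standard and the midpoint descent
inequalities. With Young's inequality the coefficients of `L * ‖x' - x‖ ^ 2` add up to `-1 + 1/4 +
(1/2 + 1/4 + 1/8) / 2 = -5/16`. The weight `1 / (4 * L)` of the gradient change is the one that
cancels against the SARAH variance bound. -/
theorem objVal_step_le_norm (h : ProblemAssumption f r u S x0 L Lu D) (hL : 0 < L)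
    (hx : r x ≠ ⊤) (hs : IsMMStep u L g x x') :
    objVal f r x' ≤ objVal f r x + ‖avgGrad f x - g‖ ^ 2 / L
      + ‖avgGrad f x' - avgGrad f x‖ ^ 2 / (4 * L) - 5 / 16 * L * ‖x' - x‖ ^ 2 := by
  have h1 := h.objVal_step_le hx hs
  have h2 := le_add_inner_add_sq_of_lipschitz_gradient h.basic.hasGradientAt_avgFun
    (h.basic.norm_avgGrad_sub_le hL.le) x x'
  have h3 := le_add_inner_add_of_lipschitz_gradient_midpoint h.basic.hasGradientAt_avgFun
    (h.basic.norm_avgGrad_sub_le hL.le) x x'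
  have young : ∀ v : EucSp d, inner ℝ v (x' - x) ≤ ‖v‖ ^ 2 / L + L / 4 * ‖x' - x‖ ^ 2 := by
    intro v
    have e1 := real_inner_le_norm v (x' - x)
    have e2 : ‖v‖ ^ 2 / L + L / 4 * ‖x' - x‖ ^ 2 - ‖v‖ * ‖x' - x‖ =
        (‖v‖ - L / 2 * ‖x' - x‖) ^ 2 / L := by field_simp; ring
    have e3 : 0 ≤ (‖v‖ - L / 2 * ‖x' - x‖) ^ 2 / L := by positivity
    linarith
  have h4 := young (avgGrad f x - g)
  have h5 := young (avgGrad f x' - avgGrad f x)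
  have e : ‖avgGrad f x' - avgGrad f x‖ ^ 2 / (4 * L) =
    ‖avgGrad f x' - avgGrad f x‖ ^ 2 / L / 4 := by field_simp
  rw [e]
  linarith

/-- The optimality condition supplies a subgradient of `u(·, x)` at `x'`; the subgradient bound
exchanges it for one of `r`, and adding the full gradient at `x'` gives an element of the
subdifferential of `F`. Its norm collects `L` from the change of gradient, `L` from the proximal
term, `Lu` from the exchange, and the estimation error. -/
theorem infEDist_sq_le (h : ProblemAssumption f r u S x0 L Lu D) (hL : 0 < L) (hLu : 0 ≤ Lu)
    (hx : r x ≠ ⊤) (hxS : x ∈ S) (hxS' : x' ∈ S) (hs : IsMMStep u L g x x') :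
    Metric.infEDist 0 (limitingSubdiff (objective f r) x') ^ 2 ≤
      ENNReal.ofReal (2 * (2 * L + Lu) ^ 2 * ‖x' - x‖ ^ 2 + 2 * ‖avgGrad f x - g‖ ^ 2) := by
  obtain ⟨ζ, hζ, hle⟩ := h.subgradient x' hxS' x hxS _
    (frechetSubdiff_subset_limitingSubdiff _ _ (hs.mem_frechetSubdiff
      (hs.surrogate_ne_top (h.surrogate_self_ne_top hx)) (h.surrogate_ne_bot _ _)))
  have hmem : avgGrad f x' + ζ ∈ limitingSubdiff (objective f r) x' :=
    add_mem_limitingSubdiff h.basic.hasGradientAt_avgFun (h.basic.continuous_avgGrad hL.le) hζ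
  have hnorm : ‖avgGrad f x' + ζ‖ ≤ (2 * L + Lu) * ‖x' - x‖ + ‖avgGrad f x - g‖ := by
    have e : avgGrad f x' + ζ = (avgGrad f x' - avgGrad f x) + (avgGrad f x - g)
        - L • (x' - x) - (-(g + L • (x' - x)) - ζ) := by abel
    have h1 := h.basic.norm_avgGrad_sub_le hL.le x' x
    have h2 : ‖L • (x' - x)‖ = L * ‖x' - x‖ := by rw [norm_smul, Real.norm_of_nonneg hL.le]
    rw [e]
    refine (norm_sub_le _ _).trans ?_
    have h3 := (norm_sub_le ((avgGrad f x' - avgGrad f x) + (avgGrad f x - g)) (L • (x' - x)))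
    have h4 := norm_add_le (avgGrad f x' - avgGrad f x) (avgGrad f x - g)
    linarith
  have h1 : Metric.infEDist 0 (limitingSubdiff (objective f r) x') ≤
      ENNReal.ofReal ‖avgGrad f x' + ζ‖ := by
    refine (Metric.infEDist_le_edist_of_mem hmem).trans_eq ?_
    rw [edist_comm, edist_dist, dist_zero_right]
  calc _ ≤ ENNReal.ofReal ‖avgGrad f x' + ζ‖ ^ 2 := by gcongr
    _ = ENNReal.ofReal (‖avgGrad f x' + ζ‖ ^ 2) := (ENNReal.ofReal_pow (norm_nonneg _) 2).symm
    _ ≤ _ := by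
        refine ENNReal.ofReal_le_ofReal ?_
        have h0 : 0 ≤ (2 * L + Lu) * ‖x' - x‖ := by positivity
        nlinarith [pow_le_pow_left₀ (norm_nonneg _) hnorm 2,
          sq_nonneg ((2 * L + Lu) * ‖x' - x‖ - ‖avgGrad f x - g‖)]

end ProblemAssumption

/-! ### Expectations of functions of the history -/

section History

variable {Ω : Type*} [MeasurableSpace Ω] {P : Measure Ω} [IsProbabilityMeasure P] {n b d m : ℕ}
  {I : ℕ → Ω → Fin b → Fin n} {c : ℕ → Ω → Bool}

omit [MeasurableSpace Ω] in
-- Being a function of the history replaces measurability: the history takes finitely many values,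
-- so such a variable is automatically integrable.
theorem factorsThrough_history {γ : Type*} {Y : Ω → γ} {p q : ℕ}
    (h : ∀ ω ω', (∀ j < p, I j ω = I j ω') → (∀ j < q, c j ω = c j ω') → Y ω = Y ω') :
    Function.FactorsThrough Y (history I c p q) := fun ω ω' he =>
  h ω ω' (fun j hj => congrFun (Prod.ext_iff.1 he).1 ⟨j, hj⟩)
    (fun j hj => congrFun (Prod.ext_iff.1 he).2 ⟨j, hj⟩)

omit [MeasurableSpace Ω] in
theorem history_factorsThrough {p q p' q' : ℕ} (hp : p ≤ p') (hq : q ≤ q') :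
    Function.FactorsThrough (history I c p q) (history I c p' q') := fun _ _ he =>
  Prod.ext (funext fun j => congrFun (Prod.ext_iff.1 he).1 (Fin.castLE hp j))
    (funext fun j => congrFun (Prod.ext_iff.1 he).2 (Fin.castLE hq j))

omit [MeasurableSpace Ω] in
theorem Function.FactorsThrough.mono_history {γ : Type*} {Y : Ω → γ} {p q p' q' : ℕ}
    (hY : Function.FactorsThrough Y (history I c p q)) (hp : p ≤ p') (hq : q ≤ q') :
    Function.FactorsThrough Y (history I c p' q') := fun _ _ he =>
  hY (history_factorsThrough hp hq he)

namespace IsCoin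

theorem integrable_of_factorsThrough (hI : IsSampling P I) (hc : IsCoin P I m c) {E : Type*}
    [NormedAddCommGroup E] {p q : ℕ} {Y : Ω → E}
    (hY : Function.FactorsThrough Y (history I c p q)) : Integrable Y P := by
  have h := integrable_comp_of_finite (P := P) (hc.measurable_history hI p q)
    -- The default `0` is taken only at histories that never occur.
    (Function.extend (history I c p q) Y 0)
  simpa only [hY.extend_apply] using h

theorem integral_batch (hI : IsSampling P I) (hc : IsCoin P I m c) {p q k : ℕ} (hpk : p ≤ k)
    {Φ : Ω → (Fin b → Fin n) → ℝ} (hΦ : Function.FactorsThrough Φ (history I c p q)) :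
    ∫ ω, Φ ω (I k ω) ∂P = ∫ ω, ∫ ω', Φ ω (I k ω') ∂P ∂P := by
  have h := integral_comp_of_indepFun (hc.measurable_history hI p q) (hI.measurable_batch k)
    (hc.indepFun_history_batch hI hpk q) (Function.extend (history I c p q) Φ 0)
  simpa only [hΦ.extend_apply] using h

theorem integral_coin_history (hI : IsSampling P I) (hc : IsCoin P I m c) {p q k : ℕ}
    (hqk : q ≤ k) {Φ : Ω → Bool → ℝ} (hΦ : Function.FactorsThrough Φ (history I c p q)) :
    ∫ ω, Φ ω (c k ω) ∂P =
      ∫ ω, (1 / (m : ℝ) * Φ ω true + (1 - 1 / (m : ℝ)) * Φ ω false) ∂P := by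
  have h := integral_comp_of_indepFun (hc.measurable_history hI p q) (hc.measurable k)
    (hc.indepFun_history_coin hI p hqk) (Function.extend (history I c p q) Φ 0)
  simp only [hΦ.extend_apply] at h
  rw [h]
  exact integral_congr_ae (.of_forall fun ω => hc.integral_coin k (Φ ω))

/-- Symmetrization conditionally on the past: the history is frozen and only the batch is copied.
Cocoercivity is needed just for realizations with a common history. -/
theorem integral_inner_le_of_unbiased (hI : IsSampling P I) (hc : IsCoin P I m c) {p q k : ℕ}
    (hpk : p ≤ k) {κ : ℝ} {e : Ω → (Fin b → Fin n) → EucSp d} {Δ : Ω → EucSp d}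
    (he : Function.FactorsThrough e (history I c p q))
    (hΔ : Function.FactorsThrough Δ fun ω => (history I c p q ω, I k ω))
    (hmean : ∀ ω, ∫ ω', e ω (I k ω') ∂P = 0)
    (hco : ∀ ω ω', history I c p q ω = history I c p q ω' →
      inner ℝ (e ω (I k ω) - e ω' (I k ω')) (Δ ω - Δ ω') ≤
        κ * ‖e ω (I k ω) - e ω' (I k ω')‖ ^ 2) :
    ∫ ω, inner ℝ (e ω (I k ω)) (Δ ω) ∂P ≤ κ * ∫ ω, ‖e ω (I k ω)‖ ^ 2 ∂P := by
  set H := history I c p q with hH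
  have hHm : Measurable H := hc.measurable_history hI p q
  have hIm := hI.measurable_batch k
  have hind := hc.indepFun_history_batch hI hpk q
  set X := Function.extend (fun ω => (H ω, I k ω)) Δ 0 with hX
  set e' := Function.extend H e 0 with he'
  have hXv : ∀ ω, Δ ω = X (H ω, I k ω) := fun ω => (hΔ.extend_apply 0 ω).symm
  have hev : ∀ ω, e ω = e' (H ω) := fun ω => (he.extend_apply 0 ω).symm
  -- Almost every recombined pair of a past and a batch is realized by some `ω`, so that `hco` can
  -- be applied to it.
  have hatt := ae_ae_of_indepFun (P := P) hHm hIm hind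
    (R := fun h β => ∃ ω, H ω = h ∧ I k ω = β) fun ω => ⟨ω, rfl, rfl⟩
  simp only [hXv, hev] at hmean hco ⊢
  rw [integral_comp_of_indepFun hHm hIm hind fun h β => (inner ℝ (e' h β) (X (h, β)) : ℝ),
    integral_comp_of_indepFun hHm hIm hind fun h β => ‖e' h β‖ ^ 2, ← integral_const_mul]
  refine integral_mono_ae
    (integrable_comp_of_finite hHm fun h => ∫ ω', (inner ℝ (e' h (I k ω')) (X (h, I k ω')) : ℝ) ∂P)
    (integrable_comp_of_finite hHm fun h => κ * ∫ ω', ‖e' h (I k ω')‖ ^ 2 ∂P) ?_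
  filter_upwards [hatt] with ω hω
  refine integral_inner_le_of_symmetrization hIm (e' (H ω)) (fun β => X (H ω, β)) (hmean ω) ?_
  filter_upwards [hω] with ω₁ h₁
  filter_upwards [hω] with ω₂ h₂
  obtain ⟨τ₁, a₁, b₁⟩ := h₁
  obtain ⟨τ₂, a₂, b₂⟩ := h₂
  have := hco τ₁ τ₂ (a₁.trans a₂.symm)
  rwa [a₁, a₂, b₁, b₂] at this

end IsCoin

end History

/-! ### Summation of recursions -/

theorem sum_le_of_recursion {q : ℝ} {s p : ℕ → ℝ} (hs0 : s 0 = 0) (hs : ∀ k, 0 ≤ s k)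
    (h : ∀ k, s (k + 1) ≤ q * s k + p k) (K : ℕ) :
    (1 - q) * ∑ k ∈ Finset.range K, s k ≤ ∑ k ∈ Finset.range K, p k := by
  -- The final term `s K` is kept so that the induction closes, and dropped afterwards.
  have key : (1 - q) * ∑ k ∈ Finset.range K, s k + s K ≤ ∑ k ∈ Finset.range K, p k := by
    induction K with
    | zero => simp [hs0]
    | succ K ih =>
      rw [Finset.sum_range_succ, Finset.sum_range_succ]
      linarith [h K]
  linarith [hs K]

/-! ### From summed bounds to stationarity -/

section Runs

variable {Ω : Type*} [MeasurableSpace Ω] {P : Measure Ω} [IsProbabilityMeasure P] {n b d m : ℕ}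
  {f : Fin n → EucSp d → ℝ} {r : EucSp d → EReal}
  {u : EucSp d → EucSp d → EReal} {S : Set (EucSp d)} {x0 : EucSp d} {L Lu D : ℝ}
  {I : ℕ → Ω → Fin b → Fin n} {c : ℕ → Ω → Bool} {x : ℕ → Ω → EucSp d}

/-- Expected squared length of the step from `x k`. -/
noncomputable def stepSq (P : Measure Ω) (x : ℕ → Ω → EucSp d) (k : ℕ) : ℝ :=
  ∫ ω, ‖x (k + 1) ω - x k ω‖ ^ 2 ∂P

/-- Expected squared error of the gradient estimate `g k`. -/
noncomputable def errSq (P : Measure Ω) (f : Fin n → EucSp d → ℝ) (x g : ℕ → Ω → EucSp d)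
    (k : ℕ) : ℝ :=
  ∫ ω, ‖avgGrad f (x k ω) - g k ω‖ ^ 2 ∂P

omit [IsProbabilityMeasure P] in
theorem ProblemAssumption.reachesStationary (h : ProblemAssumption f r u S x0 L Lu D)
    (hL : 0 < L) (hLu : 0 ≤ Lu) (hx0 : ∀ ω, x 0 ω = x0) (hS : ∀ᵐ ω ∂P, ∀ k, x k ω ∈ S)
    {g : ℕ → Ω → EucSp d} (hg : ∀ ω k, IsMMStep u L (g k ω) (x k ω) (x (k + 1) ω))
    (hd : ∀ k, Integrable (fun ω => ‖x (k + 1) ω - x k ω‖ ^ 2) P)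
    (ha : ∀ k, Integrable (fun ω => ‖avgGrad f (x k ω) - g k ω‖ ^ 2) P)
    {K : ℕ} (hK : 1 ≤ K) {ε : ℝ}
    (hsd : ∑ k ∈ Finset.range K, stepSq P x k ≤ 100 * D / L)
    (hsa : ∑ k ∈ Finset.range K, errSq P f x g k ≤
      L ^ 2 / 2 * ∑ k ∈ Finset.range K, stepSq P x k)
    (hε : (2 * (2 * L + Lu) ^ 2 + L ^ 2) * (100 * D / L) ≤ K * ε ^ 2) :
    ReachesStationary P (objective f r) x K ε := by
  -- If every iterate failed, summing the `K` strict lower bounds would contradict `hε`. The term `L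
  -- ^ 2` there is twice the factor `L ^ 2 / 2` from `hsa`.
  by_contra hcon
  have hlt : ∀ k ∈ Finset.range K,
      ε ^ 2 < 2 * (2 * L + Lu) ^ 2 * stepSq P x k + 2 * errSq P f x g k := by
    intro k hk
    by_contra hle
    refine hcon ⟨k + 1, by omega, by simpa using Finset.mem_range.1 hk, ?_⟩
    have hint : Integrable (fun ω => 2 * (2 * L + Lu) ^ 2 * ‖x (k + 1) ω - x k ω‖ ^ 2
        + 2 * ‖avgGrad f (x k ω) - g k ω‖ ^ 2) P :=
      ((hd k).const_mul _).add ((ha k).const_mul _)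
    calc ∫⁻ ω, Metric.infEDist 0 (limitingSubdiff (objective f r) (x (k + 1) ω)) ^ 2 ∂P
        ≤ ∫⁻ ω, ENNReal.ofReal (2 * (2 * L + Lu) ^ 2 * ‖x (k + 1) ω - x k ω‖ ^ 2
          + 2 * ‖avgGrad f (x k ω) - g k ω‖ ^ 2) ∂P := by
          refine lintegral_mono_ae ?_
          filter_upwards [hS] with ω hω
          exact h.infEDist_sq_le hL hLu (h.reg_ne_top (hx0 ω) (hg ω) k) (hω k) (hω (k + 1))
            (hg ω k)
      _ = ENNReal.ofReal (∫ ω, (2 * (2 * L + Lu) ^ 2 * ‖x (k + 1) ω - x k ω‖ ^ 2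
          + 2 * ‖avgGrad f (x k ω) - g k ω‖ ^ 2) ∂P) :=
          (ofReal_integral_eq_lintegral_ofReal hint (.of_forall fun ω => by positivity)).symm
      _ ≤ ENNReal.ofReal (ε ^ 2) := by
          refine ENNReal.ofReal_le_ofReal ?_
          rw [integral_add ((hd k).const_mul _) ((ha k).const_mul _), integral_const_mul,
            integral_const_mul]
          exact not_lt.1 hle
  have hsum := Finset.sum_lt_sum_of_nonempty (Finset.nonempty_range_iff.2 (by omega)) hlt
  rw [Finset.sum_add_distrib, ← Finset.mul_sum, ← Finset.mul_sum, Finset.sum_const,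
    Finset.card_range, nsmul_eq_mul] at hsum
  have h1 := mul_le_mul_of_nonneg_left hsd
    (show 0 ≤ 2 * (2 * L + Lu) ^ 2 + L ^ 2 by positivity)
  nlinarith

/-- Summing a one-step decrease of the expected objective. -/
theorem ProblemAssumption.sum_le_of_decrease (h : ProblemAssumption f r u S x0 L Lu D)
    (hx0 : ∀ ω, x 0 ω = x0) {g : ℕ → Ω → EucSp d}
    (hg : ∀ ω k, IsMMStep u L (g k ω) (x k ω) (x (k + 1) ω))
    (hint : ∀ k, Integrable (fun ω => objVal f r (x k ω)) P) {p : ℕ → ℝ}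
    (hp : ∀ k, ∫ ω, objVal f r (x (k + 1) ω) ∂P + p k ≤ ∫ ω, objVal f r (x k ω) ∂P) (K : ℕ) :
    ∑ k ∈ Finset.range K, p k ≤ D := by
  have h1 : ∫ ω, objVal f r (x K ω) ∂P + ∑ k ∈ Finset.range K, p k ≤
      ∫ ω, objVal f r (x 0 ω) ∂P := by
    induction K with
    | zero => simp
    | succ K ih => rw [Finset.sum_range_succ]; linarith [hp K]
  have h2 : ∫ ω, objVal f r (x 0 ω) ∂P ≤ ∫ ω, objVal f r (x K ω) ∂P + D := by
    have := integral_mono (hint 0) ((hint K).add (integrable_const D)) fun ω => by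
      simp only [Pi.add_apply, hx0]
      exact h.objVal_x0_le (h.reg_ne_top (hx0 ω) (hg ω) K)
    simpa only [Pi.add_apply, integral_add (hint K) (integrable_const D), integral_const,
      probReal_univ, one_smul] using this
  linarith

/-! ### Methods with a table of reference points -/

/-- Gradient estimate at `y` with reference points `T` and batch `β`. -/
noncomputable def tableEst (f : Fin n → EucSp d → ℝ) (y : EucSp d) (T : Fin n → EucSp d)
    (β : Fin b → Fin n) : EucSp d :=
  (1 / (b : ℝ)) • ∑ j, (gradient (f (β j)) y - gradient (f (β j)) (T (β j)))
    + (1 / (n : ℝ)) • ∑ i, gradient (f i) (T i)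

/-- Mean squared distance between the gradients at `y` and at the reference points. -/
noncomputable def tableGap (f : Fin n → EucSp d → ℝ) (y : EucSp d) (T : Fin n → EucSp d) : ℝ :=
  (1 / (n : ℝ)) * ∑ i, ‖gradient (f i) y - gradient (f i) (T i)‖ ^ 2

theorem tableGap_nonneg (f : Fin n → EucSp d → ℝ) (y : EucSp d) (T : Fin n → EucSp d) :
    0 ≤ tableGap f y T := by
  unfold tableGap; positivity

theorem sum_avg_sub_eq_zero (hn : 0 < n) (v : Fin n → EucSp d) :
    ∑ i, ((1 / (n : ℝ)) • ∑ l, v l - v i) = 0 := by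
  have hn' : (n : ℝ) ≠ 0 := by exact_mod_cast hn.ne'
  rw [Finset.sum_sub_distrib, Finset.sum_const, Finset.card_univ, Fintype.card_fin,
    ← Nat.cast_smul_eq_nsmul ℝ, smul_smul, mul_one_div_cancel hn', one_smul, sub_self]

/-- Variance as second moment minus squared mean. The subtracted term is discarded for table methods
but is indispensable for SARAH. -/
theorem avg_norm_avg_sub_sq (hn : 0 < n) (v : Fin n → EucSp d) :
    (1 / (n : ℝ)) * ∑ i, ‖(1 / (n : ℝ)) • ∑ l, v l - v i‖ ^ 2 =
      (1 / (n : ℝ)) * ∑ i, ‖v i‖ ^ 2 - ‖(1 / (n : ℝ)) • ∑ l, v l‖ ^ 2 := by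
  have hn' : (n : ℝ) ≠ 0 := by exact_mod_cast hn.ne'
  set a := (1 / (n : ℝ)) • ∑ l, v l with ha
  have hs : ∑ l, v l = (n : ℝ) • a := by rw [ha, smul_smul, mul_one_div_cancel hn', one_smul]
  simp only [norm_sub_sq_real, Finset.sum_add_distrib, Finset.sum_sub_distrib, ← Finset.mul_sum,
    ← inner_sum, hs, inner_smul_right, real_inner_self_eq_norm_sq]
  simp
  field_simp
  ring

/-- Exhibits the error as a batch average of vectors that sum to zero over all indices, which gives
both unbiasedness and the variance bound. -/
theorem avgGrad_sub_tableEst (hb : 0 < b) (y : EucSp d) (T : Fin n → EucSp d)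
    (β : Fin b → Fin n) :
    avgGrad f y - tableEst f y T β = (1 / (b : ℝ)) • ∑ j, ((1 / (n : ℝ)) •
      ∑ l, (gradient (f l) y - gradient (f l) (T l))
        - (gradient (f (β j)) y - gradient (f (β j)) (T (β j)))) := by
  have hb' : (b : ℝ) ≠ 0 := by exact_mod_cast hb.ne'
  rw [Finset.sum_sub_distrib, Finset.sum_const, Finset.card_univ, Fintype.card_fin,
    ← Nat.cast_smul_eq_nsmul ℝ, smul_sub, smul_smul, one_div_mul_cancel hb', one_smul,
    Finset.sum_sub_distrib (f := fun l => gradient (f l) y), smul_sub, tableEst, avgGrad]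
  abel

theorem integral_avgGrad_sub_tableEst (hI : IsSampling P I) (hn : 0 < n) (hb : 0 < b) (k : ℕ)
    (y : EucSp d) (T : Fin n → EucSp d) :
    ∫ ω, (avgGrad f y - tableEst f y T (I k ω)) ∂P = 0 := by
  simp only [avgGrad_sub_tableEst hb]
  rw [integral_smul, hI.integral_sum_eq_zero k (w := fun i => (1 / (n : ℝ)) •
      ∑ l, (gradient (f l) y - gradient (f l) (T l)) - (gradient (f i) y - gradient (f i) (T i)))
    (sum_avg_sub_eq_zero hn _), smul_zero]

theorem integral_norm_avgGrad_sub_tableEst_sq_le (hI : IsSampling P I) (hn : 0 < n) (hb : 0 < b)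
    (k : ℕ) (y : EucSp d) (T : Fin n → EucSp d) :
    ∫ ω, ‖avgGrad f y - tableEst f y T (I k ω)‖ ^ 2 ∂P ≤ 1 / (b : ℝ) * tableGap f y T := by
  simp only [avgGrad_sub_tableEst hb]
  have h := hI.integral_norm_add_avg_sq hb k 0 (w := fun i => (1 / (n : ℝ)) •
      ∑ l, (gradient (f l) y - gradient (f l) (T l)) - (gradient (f i) y - gradient (f i) (T i)))
    (sum_avg_sub_eq_zero hn _)
  simp only [zero_add, norm_zero] at h
  rw [h, avg_norm_avg_sub_sq hn, tableGap]
  have : 0 ≤ 1 / (b : ℝ) := by positivity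
  nlinarith [mul_nonneg this (sq_nonneg
    ‖(1 / (n : ℝ)) • ∑ l, (gradient (f l) y - gradient (f l) (T l))‖)]

/-- A method whose reference points after a step are determined by the previous ones, the iterates,
the batch of that step and the next coin. -/
structure IsTableRun (f : Fin n → EucSp d → ℝ) (u : EucSp d → EucSp d → EReal) (L : ℝ)
    (I : ℕ → Ω → Fin b → Fin n) (c : ℕ → Ω → Bool) (x : ℕ → Ω → EucSp d)
    (T : ℕ → Ω → Fin n → EucSp d) : Prop where
  init : ∀ ω i, T 0 ω i = x 0 ω
  step : ∀ ω k, IsMMStep u L (tableEst f (x k ω) (T k ω) (I k ω)) (x k ω) (x (k + 1) ω)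
  update : ∀ k ω ω', T k ω = T k ω' → x k ω = x k ω' → x (k + 1) ω = x (k + 1) ω' →
    I k ω = I k ω' → c (k + 1) ω = c (k + 1) ω' → T (k + 1) ω = T (k + 1) ω'

namespace IsTableRun

variable {T : ℕ → Ω → Fin n → EucSp d}

omit [MeasurableSpace Ω] in
-- Strong convexity makes each step unique, so the run is determined by its draws. The table before
-- iteration `k` may use coin `k`, hence `k + 1` coins but only `k` batches.
theorem state_eq (hT : IsTableRun f u L I c x T) (h : ProblemAssumption f r u S x0 L Lu D)
    (hL : 0 < L) (hx0 : ∀ ω, x 0 ω = x0) (k : ℕ) (ω ω' : Ω)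
    (hIe : ∀ j < k, I j ω = I j ω') (hce : ∀ j < k + 1, c j ω = c j ω') :
    x k ω = x k ω' ∧ T k ω = T k ω' := by
  induction k with
  | zero =>
    refine ⟨by rw [hx0, hx0], funext fun i => ?_⟩
    rw [hT.init, hT.init, hx0, hx0]
  | succ k ih =>
    obtain ⟨h1, h2⟩ := ih (fun j hj => hIe j (by omega)) (fun j hj => hce j (by omega))
    have h3 := hIe k (by omega)
    have h4 : x (k + 1) ω = x (k + 1) ω' := by
      have s1 := hT.step ω k
      have s2 := hT.step ω' k
      rw [← h1, ← h2, ← h3] at s2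
      exact s1.unique hL s2 (h.surrogateReg.convex_fst _)
        (h.surrogate_self_ne_top (h.reg_ne_top (hx0 ω) (hT.step ω) k))
        fun z => h.surrogate_ne_bot _ _
    exact ⟨h4, hT.update k ω ω' h2 h1 h4 h3 (hce _ (by omega))⟩

omit [MeasurableSpace Ω] in
theorem factorsThrough (hT : IsTableRun f u L I c x T)
    (h : ProblemAssumption f r u S x0 L Lu D) (hL : 0 < L) (hx0 : ∀ ω, x 0 ω = x0) (k : ℕ) :
    Function.FactorsThrough (fun ω => (x k ω, T k ω)) (history I c k (k + 1)) :=
  factorsThrough_history fun ω ω' h1 h2 => Prod.ext_iff.2 (hT.state_eq h hL hx0 k ω ω' h1 h2)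

omit [MeasurableSpace Ω] in
theorem factorsThrough_iterate (hT : IsTableRun f u L I c x T)
    (h : ProblemAssumption f r u S x0 L Lu D) (hL : 0 < L) (hx0 : ∀ ω, x 0 ω = x0) (k : ℕ) :
    Function.FactorsThrough (x k) (history I c k (k + 1)) := fun _ _ he =>
  (Prod.ext_iff.1 (hT.factorsThrough h hL hx0 k he)).1

omit [MeasurableSpace Ω] in
theorem factorsThrough_table (hT : IsTableRun f u L I c x T)
    (h : ProblemAssumption f r u S x0 L Lu D) (hL : 0 < L) (hx0 : ∀ ω, x 0 ω = x0) (k : ℕ) :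
    Function.FactorsThrough (T k) (history I c k (k + 1)) := fun _ _ he =>
  (Prod.ext_iff.1 (hT.factorsThrough h hL hx0 k he)).2

omit [MeasurableSpace Ω] in
theorem factorsThrough_step (hT : IsTableRun f u L I c x T)
    (h : ProblemAssumption f r u S x0 L Lu D) (hL : 0 < L) (hx0 : ∀ ω, x 0 ω = x0) (k : ℕ) :
    Function.FactorsThrough (fun ω => x (k + 1) ω - x k ω)
      (history I c (k + 1) (k + 2)) := fun ω ω' he => by
  have e1 := hT.factorsThrough_iterate h hL hx0 (k + 1) he
  have e2 := (hT.factorsThrough_iterate h hL hx0 k).mono_history (Nat.le_succ k)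
    (Nat.le_succ (k + 1)) he
  simp only [e1, e2]

omit [MeasurableSpace Ω] in
theorem factorsThrough_step_batch (hT : IsTableRun f u L I c x T)
    (h : ProblemAssumption f r u S x0 L Lu D) (hL : 0 < L) (hx0 : ∀ ω, x 0 ω = x0) (k : ℕ) :
    Function.FactorsThrough (fun ω => x (k + 1) ω - x k ω)
      (fun ω => (history I c k (k + 1) ω, I k ω)) := fun ω ω' he => by
  obtain ⟨he1, he2⟩ := Prod.ext_iff.1 he
  have e1 := hT.factorsThrough_iterate h hL hx0 k he1
  have e2 := hT.factorsThrough_table h hL hx0 k he1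
  have s1 := hT.step ω k
  have s2 := hT.step ω' k
  simp only at he2
  rw [← e1, ← e2, ← he2] at s2
  have e3 := s1.unique hL s2 (h.surrogateReg.convex_fst _)
    (h.surrogate_self_ne_top (h.reg_ne_top (hx0 ω) (hT.step ω) k))
    fun z => h.surrogate_ne_bot _ _
  simp only [e1, e3]

variable (hT : IsTableRun f u L I c x T) (h : ProblemAssumption f r u S x0 L Lu D) (hL : 0 < L)
  (hx0 : ∀ ω, x 0 ω = x0) (hI : IsSampling P I) (hc : IsCoin P I m c)
include hT h hL hx0 hI hc

theorem integrable_stepSq (k : ℕ) : Integrable (fun ω => ‖x (k + 1) ω - x k ω‖ ^ 2) P :=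
  hc.integrable_of_factorsThrough hI fun ω ω' he => by
    have := hT.factorsThrough_step h hL hx0 k he
    simp only at this ⊢
    rw [this]

theorem integrable_errSq (k : ℕ) : Integrable (fun ω =>
    ‖avgGrad f (x k ω) - tableEst f (x k ω) (T k ω) (I k ω)‖ ^ 2) P :=
  hc.integrable_of_factorsThrough hI (p := k + 1) (q := k + 1) fun ω ω' he => by
    have e1 := (hT.factorsThrough_iterate h hL hx0 k).mono_history (Nat.le_succ k) le_rfl he
    have e2 := (hT.factorsThrough_table h hL hx0 k).mono_history (Nat.le_succ k) le_rfl he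
    have e3 : I k ω = I k ω' := congrFun (Prod.ext_iff.1 he).1 ⟨k, Nat.lt_succ_self k⟩
    simp only [e1, e2, e3]

theorem integrable_objVal (k : ℕ) : Integrable (fun ω => objVal f r (x k ω)) P :=
  hc.integrable_of_factorsThrough hI (p := k) (q := k + 1) fun ω ω' he => by
    simp only [hT.factorsThrough_iterate h hL hx0 k he]

theorem integrable_tableGap (k : ℕ) : Integrable (fun ω => tableGap f (x k ω) (T k ω)) P :=
  hc.integrable_of_factorsThrough hI (p := k) (q := k + 1) fun ω ω' he => by
    simp only [hT.factorsThrough_iterate h hL hx0 k he, hT.factorsThrough_table h hL hx0 k he]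

theorem errSq_le (hn : 0 < n) (hb : 0 < b) (k : ℕ) :
    errSq P f x (fun k ω => tableEst f (x k ω) (T k ω) (I k ω)) k ≤
      1 / (b : ℝ) * ∫ ω, tableGap f (x k ω) (T k ω) ∂P := by
  have hΦ : Function.FactorsThrough (fun ω (β : Fin b → Fin n) =>
      ‖avgGrad f (x k ω) - tableEst f (x k ω) (T k ω) β‖ ^ 2) (history I c k (k + 1)) :=
    fun ω ω' he => by
      simp only [hT.factorsThrough_iterate h hL hx0 k he, hT.factorsThrough_table h hL hx0 k he]
  rw [errSq, hc.integral_batch hI le_rfl hΦ, ← integral_const_mul]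
  refine integral_mono (hc.integrable_of_factorsThrough hI (p := k) (q := k + 1)
    fun ω ω' he => ?_)
    ((hT.integrable_tableGap h hL hx0 hI hc k).const_mul _) fun ω =>
    integral_norm_avgGrad_sub_tableEst_sq_le hI hn hb k _ _
  simp only [hT.factorsThrough_iterate h hL hx0 k he, hT.factorsThrough_table h hL hx0 k he]

theorem integral_inner_le (hn : 0 < n) (hb : 0 < b) (k : ℕ) :
    ∫ ω, inner ℝ (avgGrad f (x k ω) - tableEst f (x k ω) (T k ω) (I k ω))
      (x (k + 1) ω - x k ω) ∂P ≤
    1 / L * errSq P f x (fun k ω => tableEst f (x k ω) (T k ω) (I k ω)) k := by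
  refine hc.integral_inner_le_of_unbiased hI (p := k) (q := k + 1) le_rfl
    (e := fun ω β => avgGrad f (x k ω) - tableEst f (x k ω) (T k ω) β)
    (fun ω ω' he => ?_) (hT.factorsThrough_step_batch h hL hx0 k)
    (fun ω => integral_avgGrad_sub_tableEst hI hn hb k _ _) fun ω ω' he => ?_
  · simp only [hT.factorsThrough_iterate h hL hx0 k he, hT.factorsThrough_table h hL hx0 k he]
  · have s1 := hT.step ω k
    have s2 := hT.step ω' k
    rw [← hT.factorsThrough_iterate h hL hx0 k he] at s2 ⊢
    have := s1.inner_sub_le hL s2 (h.surrogateReg.convex_fst _)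
      (h.surrogate_self_ne_top (h.reg_ne_top (hx0 ω) (hT.step ω) k))
      fun z => h.surrogate_ne_bot _ _
    rw [sub_sub_sub_cancel_left, sub_sub_sub_cancel_right, one_div_mul_eq_div]
    exact this

/-- Since the initial gap is zero, summing the recursion gives `∑ gap ≤ L ^ 2 / (1 - q) ^ 2 * ∑
stepSq`, and the variance factor `1 / b` produces the quantity in `hbq`. The summed decrease then
retains `L / 2 - 49 / 100 * L = L / 100`, whence the bound `100 * D / L`. -/
theorem sum_bounds (hn : 0 < n) (hb : 0 < b) {q : ℝ} (hq : q < 1)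
    (hbq : 1 / (b * (1 - q) ^ 2) ≤ 49 / 100)
    (hrec : ∀ k, ∫ ω, tableGap f (x (k + 1) ω) (T (k + 1) ω) ∂P ≤
      q * ∫ ω, tableGap f (x k ω) (T k ω) ∂P + L ^ 2 / (1 - q) * stepSq P x k) (K : ℕ) :
    ∑ k ∈ Finset.range K, stepSq P x k ≤ 100 * D / L ∧
    ∑ k ∈ Finset.range K, errSq P f x (fun k ω => tableEst f (x k ω) (T k ω) (I k ω)) k ≤
      L ^ 2 / 2 * ∑ k ∈ Finset.range K, stepSq P x k := by
  set a := errSq P f x (fun k ω => tableEst f (x k ω) (T k ω) (I k ω)) with ha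
  have hb' : (0 : ℝ) < b := by exact_mod_cast hb
  have hq' : 0 < 1 - q := by linarith
  have hdnn : 0 ≤ ∑ k ∈ Finset.range K, stepSq P x k :=
    Finset.sum_nonneg fun k _ => integral_nonneg fun ω => by positivity
  have hgap := sum_le_of_recursion (s := fun k => ∫ ω, tableGap f (x k ω) (T k ω) ∂P) (by
    simp [tableGap, hT.init]) (fun k => integral_nonneg fun ω => tableGap_nonneg _ _ _) hrec K
  rw [← Finset.mul_sum] at hgap
  have hsa : ∑ k ∈ Finset.range K, a k ≤
      49 / 100 * L ^ 2 * ∑ k ∈ Finset.range K, stepSq P x k := by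
    calc ∑ k ∈ Finset.range K, a k
        ≤ ∑ k ∈ Finset.range K, 1 / (b : ℝ) * ∫ ω, tableGap f (x k ω) (T k ω) ∂P :=
          Finset.sum_le_sum fun k _ => hT.errSq_le h hL hx0 hI hc hn hb k
      _ = 1 / (b : ℝ) * ∑ k ∈ Finset.range K, ∫ ω, tableGap f (x k ω) (T k ω) ∂P :=
          (Finset.mul_sum _ _ _).symm
      _ ≤ 1 / (b : ℝ) * (L ^ 2 / (1 - q) * ∑ k ∈ Finset.range K, stepSq P x k / (1 - q)) := by
          rw [← Finset.sum_div, ← mul_div_assoc]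
          gcongr
          rw [le_div_iff₀ hq', mul_comm]
          exact hgap
      _ = 1 / (b * (1 - q) ^ 2) * (L ^ 2 * ∑ k ∈ Finset.range K, stepSq P x k) := by
          rw [← Finset.sum_div]; field_simp
      _ ≤ 49 / 100 * (L ^ 2 * ∑ k ∈ Finset.range K, stepSq P x k) := by gcongr
      _ = _ := by ring
  have hdec := h.sum_le_of_decrease hx0 (g := fun k ω => tableEst f (x k ω) (T k ω) (I k ω))
    hT.step (hT.integrable_objVal h hL hx0 hI hc)
    (p := fun k => L / 2 * stepSq P x k - 1 / L * a k) (fun k => by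
      have hin : Integrable (fun ω => (inner ℝ (avgGrad f (x k ω)
          - tableEst f (x k ω) (T k ω) (I k ω)) (x (k + 1) ω - x k ω) : ℝ)) P :=
        hc.integrable_of_factorsThrough hI (p := k + 1) (q := k + 2) fun ω ω' he => by
          have e1 := (hT.factorsThrough_iterate h hL hx0 k).mono_history (Nat.le_succ k)
            (Nat.le_succ _) he
          have e2 := (hT.factorsThrough_table h hL hx0 k).mono_history (Nat.le_succ k)
            (Nat.le_succ _) he
          have e3 : I k ω = I k ω' := congrFun (Prod.ext_iff.1 he).1 ⟨k, Nat.lt_succ_self k⟩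
          have e4 := hT.factorsThrough_iterate h hL hx0 (k + 1) he
          simp only [e1, e2, e3, e4]
      have i1 := hT.integrable_objVal h hL hx0 hI hc k
      have i2 := (hT.integrable_stepSq h hL hx0 hI hc k).const_mul (L / 2)
      have h1 := integral_mono (hT.integrable_objVal h hL hx0 hI hc (k + 1))
        (show Integrable (fun ω => objVal f r (x k ω) + inner ℝ (avgGrad f (x k ω)
          - tableEst f (x k ω) (T k ω) (I k ω)) (x (k + 1) ω - x k ω)
          - L / 2 * ‖x (k + 1) ω - x k ω‖ ^ 2) P from (i1.fun_add hin).sub i2) fun ω =>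
          h.objVal_step_le_inner hL.le (h.reg_ne_top (hx0 ω) (hT.step ω) k) (hT.step ω k)
      rw [integral_sub (i1.fun_add hin) i2, integral_add i1 hin, integral_const_mul] at h1
      have h2 := hT.integral_inner_le h hL hx0 hI hc hn hb k
      rw [← ha] at h2
      have h3 : stepSq P x k = ∫ ω, ‖x (k + 1) ω - x k ω‖ ^ 2 ∂P := rfl
      rw [← h3] at h1
      linarith) K
  rw [Finset.sum_sub_distrib, ← Finset.mul_sum, ← Finset.mul_sum] at hdec
  refine ⟨?_, hsa.trans (by nlinarith [mul_nonneg (sq_nonneg L) hdnn])⟩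
  have h1 : 1 / L * ∑ k ∈ Finset.range K, a k ≤
      49 / 100 * L * ∑ k ∈ Finset.range K, stepSq P x k := by
    rw [one_div_mul_eq_div, div_le_iff₀ hL]
    linarith
  rw [le_div_iff₀ hL]
  linarith

theorem reachesStationary (hLu : 0 ≤ Lu) (hS : ∀ᵐ ω ∂P, ∀ k, x k ω ∈ S) (hn : 0 < n)
    (hb : 0 < b) {q : ℝ} (hq : q < 1) (hbq : 1 / (b * (1 - q) ^ 2) ≤ 49 / 100)
    (hrec : ∀ k, ∫ ω, tableGap f (x (k + 1) ω) (T (k + 1) ω) ∂P ≤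
      q * ∫ ω, tableGap f (x k ω) (T k ω) ∂P + L ^ 2 / (1 - q) * stepSq P x k)
    {K : ℕ} (hK : 1 ≤ K) {ε : ℝ}
    (hε : (2 * (2 * L + Lu) ^ 2 + L ^ 2) * (100 * D / L) ≤ K * ε ^ 2) :
    ReachesStationary P (objective f r) x K ε := by
  obtain ⟨h1, h2⟩ := hT.sum_bounds h hL hx0 hI hc hn hb hq hbq hrec K
  exact h.reachesStationary hL hLu hx0 hS (g := fun k ω => tableEst f (x k ω) (T k ω) (I k ω))
    hT.step (hT.integrable_stepSq h hL hx0 hI hc) (hT.integrable_errSq h hL hx0 hI hc) hK h1 h2 hε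

end IsTableRun

end Runs

/-! ### MM-SAGA and MM-SVRG -/

/-- Young's inequality with weights fitted to a table entry that survives with probability at most
`q ^ 2`: the factor `1 / q` still leaves a contraction by `q`. -/
theorem norm_add_sq_le_of_lt_one {d : ℕ} {q : ℝ} (hq0 : 0 < q) (hq1 : q < 1) (v w : EucSp d) :
    ‖v + w‖ ^ 2 ≤ 1 / q * ‖v‖ ^ 2 + 1 / (1 - q) * ‖w‖ ^ 2 := by
  have hq' : 0 < 1 - q := by linarith
  have h1 := real_inner_le_norm v w
  have h2 : 1 / q * ‖v‖ ^ 2 + 1 / (1 - q) * ‖w‖ ^ 2 - (‖v‖ ^ 2 + 2 * (‖v‖ * ‖w‖) + ‖w‖ ^ 2) =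
      ((1 - q) * ‖v‖ - q * ‖w‖) ^ 2 / (q * (1 - q)) := by
    field_simp; ring
  have h3 : 0 ≤ ((1 - q) * ‖v‖ - q * ‖w‖) ^ 2 / (q * (1 - q)) := by positivity
  rw [norm_add_sq_real]
  linarith

section Runs

variable {Ω : Type*} [MeasurableSpace Ω] {P : Measure Ω} [IsProbabilityMeasure P] {n b d m : ℕ}
  {f : Fin n → EucSp d → ℝ} {r : EucSp d → EReal}
  {u : EucSp d → EucSp d → EReal} {S : Set (EucSp d)} {x0 : EucSp d} {L Lu D : ℝ}
  {I : ℕ → Ω → Fin b → Fin n} {c : ℕ → Ω → Bool} {x : ℕ → Ω → EucSp d}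

omit [MeasurableSpace Ω] in
-- SAGA uses no coins; a constant coin places it in the same framework as SVRG.
theorem isTableRun_saga
    (hx : ∀ ω, IsMMSaga f u L (fun k => I k ω) (fun k => x k ω)) :
    IsTableRun f u L I (fun _ _ => true) x
      fun k ω => sagaTable (fun k => x k ω) (fun k => I k ω) k where
  init _ _ := rfl
  step ω k := hx ω k
  update k ω ω' h1 h2 _ h3 _ := by
    funext i
    simp only [sagaTable, h1, h2, h3]

/-- An entry keeps its old reference point only if the batch misses its index, which has probability
`(1 - 1 / n) ^ b`; surviving entries are bounded by the weighted Young inequality. -/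
theorem saga_tableGap_recursion (h : ProblemAssumption f r u S x0 L Lu D) (hL : 0 < L)
    (hx0 : ∀ ω, x 0 ω = x0) (hI : IsSampling P I)
    (hx : ∀ ω, IsMMSaga f u L (fun k => I k ω) (fun k => x k ω)) {q : ℝ} (hq0 : 0 < q)
    (hq1 : q < 1) (hq : (1 - 1 / (n : ℝ)) ^ b ≤ q ^ 2) (k : ℕ) :
    ∫ ω, tableGap f (x (k + 1) ω) (sagaTable (fun k => x k ω) (fun k => I k ω) (k + 1)) ∂P ≤
      q * ∫ ω, tableGap f (x k ω) (sagaTable (fun k => x k ω) (fun k => I k ω) k) ∂P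
        + L ^ 2 / (1 - q) * stepSq P x k := by
  classical
  have hT := isTableRun_saga hx
  have hc : IsCoin P I 1 fun _ _ => true := IsCoin.const_true I
  set T : ℕ → Ω → Fin n → EucSp d := fun k ω => sagaTable (fun k => x k ω) (fun k => I k ω) k
  have hq' : 0 < 1 - q := by linarith
  set Φ : Ω → (Fin b → Fin n) → ℝ := fun ω β => (1 / (n : ℝ)) * ∑ i,
    if ∃ j, β j = i then 0 else ‖gradient (f i) (x k ω) - gradient (f i) (T k ω i)‖ ^ 2 with hΦ
  have hpath : ∀ ω, tableGap f (x (k + 1) ω) (T (k + 1) ω) ≤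
      1 / q * Φ ω (I k ω) + L ^ 2 / (1 - q) * ‖x (k + 1) ω - x k ω‖ ^ 2 := by
    intro ω
    have hi : ∀ i, ‖gradient (f i) (x (k + 1) ω) - gradient (f i) (T (k + 1) ω i)‖ ^ 2 ≤
        1 / q * (if ∃ j, I k ω j = i then 0 else
          ‖gradient (f i) (x k ω) - gradient (f i) (T k ω i)‖ ^ 2)
        + 1 / (1 - q) * ‖gradient (f i) (x (k + 1) ω) - gradient (f i) (x k ω)‖ ^ 2 := by
      intro i
      have hTi : T (k + 1) ω i = if ∃ j, I k ω j = i then x k ω else T k ω i := by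
        simp only [T, sagaTable]
      rw [hTi]
      split_ifs with hmem
      -- A refreshed entry refers to `x k`, not to `x (k + 1)`, so the change of gradient over the
      -- step remains.
      · rw [mul_zero, zero_add]
        refine le_mul_of_one_le_left (sq_nonneg _) ?_
        rw [le_div_iff₀ hq']; linarith
      · have := norm_add_sq_le_of_lt_one hq0 hq1
          (gradient (f i) (x k ω) - gradient (f i) (T k ω i))
          (gradient (f i) (x (k + 1) ω) - gradient (f i) (x k ω))
        rwa [add_comm (gradient (f i) (x k ω) - gradient (f i) (T k ω i)),
          sub_add_sub_cancel] at this
    have h1 := h.basic.avgSmooth (x (k + 1) ω) (x k ω)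
    calc tableGap f (x (k + 1) ω) (T (k + 1) ω)
        ≤ (1 / (n : ℝ)) * ∑ i, (1 / q * (if ∃ j, I k ω j = i then 0 else
          ‖gradient (f i) (x k ω) - gradient (f i) (T k ω i)‖ ^ 2)
        + 1 / (1 - q) * ‖gradient (f i) (x (k + 1) ω) - gradient (f i) (x k ω)‖ ^ 2) := by
          unfold tableGap
          gcongr with i
          exact hi i
      _ = 1 / q * Φ ω (I k ω) + 1 / (1 - q) * ((1 / (n : ℝ)) *
          ∑ i, ‖gradient (f i) (x (k + 1) ω) - gradient (f i) (x k ω)‖ ^ 2) := by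
          rw [Finset.sum_add_distrib, ← Finset.mul_sum, ← Finset.mul_sum]
          ring
      _ ≤ 1 / q * Φ ω (I k ω) + 1 / (1 - q) * (L ^ 2 * ‖x (k + 1) ω - x k ω‖ ^ 2) := by gcongr
      _ = _ := by ring
  have hΦf : Function.FactorsThrough Φ (history I (fun _ _ => true) k (k + 1)) :=
    fun ω ω' he => by
      simp only [hΦ, hT.factorsThrough_iterate h hL hx0 k he,
        hT.factorsThrough_table h hL hx0 k he]
  have hΦint : ∫ ω, Φ ω (I k ω) ∂P = (1 - 1 / (n : ℝ)) ^ b * ∫ ω, tableGap f (x k ω) (T k ω) ∂P := by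
    rw [hc.integral_batch hI le_rfl hΦf, ← integral_const_mul]
    refine integral_congr_ae (.of_forall fun ω => ?_)
    simp only [hΦ, tableGap]
    have hind : ∀ i (s : ℝ), ∫ ω', (if ∃ j, I k ω' j = i then 0 else s) ∂P =
        (1 - 1 / (n : ℝ)) ^ b * s := by
      intro i s
      have hm : MeasurableSet {ω' | ¬∃ j, I k ω' j = i} :=
        hI.measurable_batch k (MeasurableSet.of_discrete (s := {β : Fin b → Fin n | ¬∃ j, β j = i}))
      have e : (fun ω' => if ∃ j, I k ω' j = i then 0 else s) =
          {ω' | ¬∃ j, I k ω' j = i}.indicator fun _ => s := by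
        funext ω'
        by_cases hω : ∃ j, I k ω' j = i <;> simp [Set.indicator, hω]
      rw [e, integral_indicator_const _ hm, hI.measureReal_notMem_batch, smul_eq_mul]
    rw [integral_const_mul, integral_finsetSum _ fun i _ => integrable_comp_of_finite
      (hI.measurable_batch k) fun β => if ∃ j, β j = i then (0 : ℝ) else
        ‖gradient (f i) (x k ω) - gradient (f i) (T k ω i)‖ ^ 2]
    simp only [hind]
    rw [← Finset.mul_sum]
    ring
  have hi1 : Integrable (fun ω => 1 / q * Φ ω (I k ω)) P :=
    hc.integrable_of_factorsThrough hI (p := k + 1) (q := k + 1) fun ω ω' he => by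
      have e1 := hΦf.mono_history (Nat.le_succ k) le_rfl he
      have e3 : I k ω = I k ω' := congrFun (Prod.ext_iff.1 he).1 ⟨k, Nat.lt_succ_self k⟩
      simp only [e1, e3]
  have hi2 := (hT.integrable_stepSq h hL hx0 hI hc k).const_mul (L ^ 2 / (1 - q))
  have h1 := integral_mono (hT.integrable_tableGap h hL hx0 hI hc (k + 1))
    (hi1.fun_add hi2) hpath
  have h2 : ∫ ω, 1 / q * Φ ω (I k ω) ∂P = 1 / q * ∫ ω, Φ ω (I k ω) ∂P := integral_const_mul _ _
  rw [integral_add hi1 hi2, h2, hΦint, integral_const_mul (L ^ 2 / (1 - q))] at h1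
  refine h1.trans (add_le_add ?_ le_rfl)
  have hG : 0 ≤ ∫ ω, tableGap f (x k ω) (T k ω) ∂P := integral_nonneg fun ω => tableGap_nonneg _ _ _
  calc 1 / q * ((1 - 1 / (n : ℝ)) ^ b * ∫ ω, tableGap f (x k ω) (T k ω) ∂P)
      ≤ 1 / q * (q ^ 2 * ∫ ω, tableGap f (x k ω) (T k ω) ∂P) := by gcongr
    _ = q * ∫ ω, tableGap f (x k ω) (T k ω) ∂P := by field_simp

omit [MeasurableSpace Ω] in
theorem isTableRun_svrg
    (hx : ∀ ω, IsMMSvrg f u L (fun k => I k ω) (fun k => c k ω) (fun k => x k ω)) :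
    IsTableRun f u L I c x
      fun k ω _ => svrgAnchor (fun k => x k ω) (fun k => c k ω) k where
  init _ _ := rfl
  step ω k := hx ω k
  update k ω ω' h1 _ h2 _ h3 := by
    funext i
    have := congrFun h1 i
    simp only [svrgAnchor, h2, h3] at this ⊢
    rw [this]

theorem svrg_tableGap_recursion (h : ProblemAssumption f r u S x0 L Lu D) (hL : 0 < L)
    (hx0 : ∀ ω, x 0 ω = x0) (hI : IsSampling P I) (hc : IsCoin P I m c)
    (hx : ∀ ω, IsMMSvrg f u L (fun k => I k ω) (fun k => c k ω) (fun k => x k ω)) {q : ℝ}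
    (hq0 : 0 < q) (hq1 : q < 1) (hq : 1 - 1 / (m : ℝ) ≤ q ^ 2) (k : ℕ) :
    ∫ ω, tableGap f (x (k + 1) ω)
        (fun _ => svrgAnchor (fun k => x k ω) (fun k => c k ω) (k + 1)) ∂P ≤
      q * ∫ ω, tableGap f (x k ω) (fun _ => svrgAnchor (fun k => x k ω) (fun k => c k ω) k) ∂P
        + L ^ 2 / (1 - q) * stepSq P x k := by
  have hT := isTableRun_svrg hx
  set T : ℕ → Ω → Fin n → EucSp d := fun k ω _ =>
    svrgAnchor (fun k => x k ω) (fun k => c k ω) k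
  have hq' : 0 < 1 - q := by linarith
  set Φ : Ω → Bool → ℝ := fun ω t => if t then 0 else tableGap f (x k ω) (T k ω) with hΦ
  have hpath : ∀ ω, tableGap f (x (k + 1) ω) (T (k + 1) ω) ≤
      1 / q * Φ ω (c (k + 1) ω) + L ^ 2 / (1 - q) * ‖x (k + 1) ω - x k ω‖ ^ 2 := by
    intro ω
    have hTi : T (k + 1) ω = if c (k + 1) ω then fun _ => x (k + 1) ω else T k ω := by
      funext i
      simp only [T, svrgAnchor]
      split_ifs <;> rfl
    rw [hTi]
    simp only [hΦ]
    -- When the coin shows `true` the anchor is the new iterate itself and the gap vanishes.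
    split_ifs with hcoin
    · simp only [tableGap, sub_self, norm_zero]
      simp
      positivity
    · have h1 := h.basic.avgSmooth (x (k + 1) ω) (x k ω)
      calc tableGap f (x (k + 1) ω) (T k ω)
          ≤ (1 / (n : ℝ)) * ∑ i,
            (1 / q * ‖gradient (f i) (x k ω) - gradient (f i) (T k ω i)‖ ^ 2
            + 1 / (1 - q) * ‖gradient (f i) (x (k + 1) ω) - gradient (f i) (x k ω)‖ ^ 2) := by
            unfold tableGap
            gcongr with i
            have := norm_add_sq_le_of_lt_one hq0 hq1
              (gradient (f i) (x k ω) - gradient (f i) (T k ω i))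
              (gradient (f i) (x (k + 1) ω) - gradient (f i) (x k ω))
            rwa [add_comm (gradient (f i) (x k ω) - gradient (f i) (T k ω i)),
              sub_add_sub_cancel] at this
        _ = 1 / q * tableGap f (x k ω) (T k ω) + 1 / (1 - q) * ((1 / (n : ℝ)) *
            ∑ i, ‖gradient (f i) (x (k + 1) ω) - gradient (f i) (x k ω)‖ ^ 2) := by
            rw [Finset.sum_add_distrib, ← Finset.mul_sum, ← Finset.mul_sum, tableGap]
            ring
        _ ≤ 1 / q * tableGap f (x k ω) (T k ω)
            + 1 / (1 - q) * (L ^ 2 * ‖x (k + 1) ω - x k ω‖ ^ 2) := by gcongr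
        _ = _ := by ring
  have hΦf : Function.FactorsThrough Φ (history I c k (k + 1)) := fun ω ω' he => by
    simp only [hΦ, hT.factorsThrough_iterate h hL hx0 k he,
      hT.factorsThrough_table h hL hx0 k he]
  have hΦint : ∫ ω, Φ ω (c (k + 1) ω) ∂P =
      (1 - 1 / (m : ℝ)) * ∫ ω, tableGap f (x k ω) (T k ω) ∂P := by
    rw [hc.integral_coin_history hI le_rfl hΦf, ← integral_const_mul]
    simp [hΦ]
  have hi1 : Integrable (fun ω => 1 / q * Φ ω (c (k + 1) ω)) P :=
    hc.integrable_of_factorsThrough hI (p := k) (q := k + 2) fun ω ω' he => by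
      have e1 := hΦf.mono_history le_rfl (Nat.le_succ _) he
      have e3 : c (k + 1) ω = c (k + 1) ω' :=
        congrFun (Prod.ext_iff.1 he).2 ⟨k + 1, Nat.lt_succ_self _⟩
      simp only [e1, e3]
  have hi2 := (hT.integrable_stepSq h hL hx0 hI hc k).const_mul (L ^ 2 / (1 - q))
  have h1 := integral_mono (hT.integrable_tableGap h hL hx0 hI hc (k + 1))
    (hi1.fun_add hi2) hpath
  rw [integral_add hi1 hi2, integral_const_mul, integral_const_mul, hΦint] at h1
  refine h1.trans (add_le_add ?_ le_rfl)
  have hG : 0 ≤ ∫ ω, tableGap f (x k ω) (T k ω) ∂P := integral_nonneg fun ω => tableGap_nonneg _ _ _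
  calc 1 / q * ((1 - 1 / (m : ℝ)) * ∫ ω, tableGap f (x k ω) (T k ω) ∂P)
      ≤ 1 / q * (q ^ 2 * ∫ ω, tableGap f (x k ω) (T k ω) ∂P) := by gcongr
    _ = q * ∫ ω, tableGap f (x k ω) (T k ω) ∂P := by field_simp

/-! ### MM-SARAH -/

/-- Expected squared change of the full gradient in the step from `x k`. -/
noncomputable def gradStepSq (P : Measure Ω) (f : Fin n → EucSp d → ℝ) (x : ℕ → Ω → EucSp d)
    (k : ℕ) : ℝ :=
  ∫ ω, ‖avgGrad f (x (k + 1) ω) - avgGrad f (x k ω)‖ ^ 2 ∂P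

/-- The gradient estimates of MM-SARAH as random variables. -/
noncomputable def sarahGrad (f : Fin n → EucSp d → ℝ) (I : ℕ → Ω → Fin b → Fin n)
    (c : ℕ → Ω → Bool) (x : ℕ → Ω → EucSp d) (k : ℕ) (ω : Ω) : EucSp d :=
  sarahEst f (fun k => x k ω) (fun k => I k ω) (fun k => c k ω) k

namespace IsMMSarah

variable (hx : ∀ ω, IsMMSarah f u L (fun k => I k ω) (fun k => c k ω) (fun k => x k ω))
  (h : ProblemAssumption f r u S x0 L Lu D) (hL : 0 < L) (hx0 : ∀ ω, x 0 ω = x0)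
include hx h hL hx0

omit [MeasurableSpace Ω] in
theorem state_eq (k : ℕ) (ω ω' : Ω)
    (hIe : ∀ j < k + 1, I j ω = I j ω') (hce : ∀ j < k + 1, c j ω = c j ω') :
    x k ω = x k ω' ∧ sarahGrad f I c x k ω = sarahGrad f I c x k ω' ∧
      x (k + 1) ω = x (k + 1) ω' := by
  have huniq : ∀ k, x k ω = x k ω' → sarahGrad f I c x k ω = sarahGrad f I c x k ω' →
      x (k + 1) ω = x (k + 1) ω' := fun k h1 h2 => by
    have s1 : IsMMStep u L (sarahGrad f I c x k ω) (x k ω) (x (k + 1) ω) := hx ω k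
    have s2 : IsMMStep u L (sarahGrad f I c x k ω') (x k ω') (x (k + 1) ω') := hx ω' k
    rw [← h1, ← h2] at s2
    exact s1.unique hL s2 (h.surrogateReg.convex_fst _)
      (h.surrogate_self_ne_top (h.reg_ne_top (hx0 ω) (hx ω) k))
      fun z => h.surrogate_ne_bot _ _
  induction k with
  | zero =>
    have h1 : x 0 ω = x 0 ω' := by rw [hx0, hx0]
    have h2 : sarahGrad f I c x 0 ω = sarahGrad f I c x 0 ω' := by
      simp only [sarahGrad, sarahEst, h1]
    exact ⟨h1, h2, huniq 0 h1 h2⟩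
  | succ k ih =>
    obtain ⟨h1, h2, h3⟩ := ih (fun j hj => hIe j (by omega)) (fun j hj => hce j (by omega))
    have h4 : sarahGrad f I c x (k + 1) ω = sarahGrad f I c x (k + 1) ω' := by
      simp only [sarahGrad, sarahEst] at h2 ⊢
      rw [h2, h1, h3, hIe (k + 1) (by omega), hce (k + 1) (by omega)]
    exact ⟨h3, h4, huniq (k + 1) h3 h4⟩

omit [MeasurableSpace Ω] in
theorem factorsThrough (k : ℕ) :
    Function.FactorsThrough (fun ω => (x k ω, sarahGrad f I c x k ω, x (k + 1) ω))
      (history I c (k + 1) (k + 1)) :=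
  factorsThrough_history fun ω ω' h1 h2 => by
    obtain ⟨e1, e2, e3⟩ := state_eq hx h hL hx0 k ω ω' h1 h2
    simp only [e1, e2, e3]

variable (hI : IsSampling P I) (hc : IsCoin P I m c)
include hI hc

theorem integrable_state {E : Type*} [NormedAddCommGroup E] (k : ℕ)
    (φ : EucSp d → EucSp d → EucSp d → E) :
    Integrable (fun ω => φ (x k ω) (sarahGrad f I c x k ω) (x (k + 1) ω)) P :=
  hc.integrable_of_factorsThrough hI (p := k + 1) (q := k + 1) fun ω ω' he => by
    have := factorsThrough hx h hL hx0 k he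
    simp only [Prod.mk.injEq] at this
    simp only [this.1, this.2.1, this.2.2]

/-- A full gradient removes the error. Otherwise a batch term, centred given the past, is added to
the old error, so the squares add; its variance is a mean square, at most `L ^ 2 * stepSq`, minus
the squared change of the full gradient. -/
theorem errSq_succ_le (hn : 0 < n) (hb : 0 < b) (hm : 0 < m) (k : ℕ) :
    errSq P f x (sarahGrad f I c x) (k + 1) ≤
      (1 - 1 / (m : ℝ)) * errSq P f x (sarahGrad f I c x) k
      + (1 - 1 / (m : ℝ)) * (1 / (b : ℝ) * (L ^ 2 * stepSq P x k - gradStepSq P f x k)) := by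
  have hm1 : 0 ≤ 1 - 1 / (m : ℝ) := by
    rw [sub_nonneg, div_le_one (by exact_mod_cast hm)]
    exact_mod_cast hm
  have hb0 : 0 ≤ 1 / (b : ℝ) := by positivity
  set δ : Ω → Fin n → EucSp d := fun ω i =>
    gradient (f i) (x (k + 1) ω) - gradient (f i) (x k ω) with hδ
  set w : Ω → Fin n → EucSp d := fun ω i => (1 / (n : ℝ)) • ∑ l, δ ω l - δ ω i with hw
  set e : Ω → EucSp d := fun ω => avgGrad f (x k ω) - sarahGrad f I c x k ω with he
  -- The coin `k + 1` is frozen with the past while batch `k + 1` is averaged; the coin is averaged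
  -- afterwards.
  set Φ : Ω → (Fin b → Fin n) → ℝ := fun ω β =>
    if c (k + 1) ω then 0 else ‖e ω + (1 / (b : ℝ)) • ∑ j, w ω (β j)‖ ^ 2 with hΦ
  set Ψ : Ω → ℝ := fun ω =>
    ‖e ω‖ ^ 2 + 1 / (b : ℝ) * ((1 / (n : ℝ)) * ∑ i, ‖w ω i‖ ^ 2) with hΨ
  have hδavg : ∀ ω, (1 / (n : ℝ)) • ∑ l, δ ω l = avgGrad f (x (k + 1) ω) - avgGrad f (x k ω) :=
    fun ω => (BasicAssumption.avgGrad_sub _ _).symm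
  have hpath : ∀ ω, ‖avgGrad f (x (k + 1) ω) - sarahGrad f I c x (k + 1) ω‖ ^ 2 =
      Φ ω (I (k + 1) ω) := by
    intro ω
    simp only [hΦ]
    split_ifs with hcoin
    · simp [sarahGrad, sarahEst, hcoin]
    · congr 2
      have hb' : (b : ℝ) ≠ 0 := by exact_mod_cast hb.ne'
      have e1 : sarahGrad f I c x (k + 1) ω =
          (1 / (b : ℝ)) • ∑ j, δ ω (I (k + 1) ω j) + sarahGrad f I c x k ω := by
        simp only [sarahGrad, sarahEst, hδ]
        rw [if_neg hcoin]
      rw [e1]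
      simp only [hw, he]
      rw [Finset.sum_sub_distrib (f := fun _ => (1 / (n : ℝ)) • ∑ l, δ ω l), Finset.sum_const, Finset.card_univ, Fintype.card_fin,
        ← Nat.cast_smul_eq_nsmul ℝ, smul_sub, smul_smul, one_div_mul_cancel hb', one_smul, hδavg]
      abel
  have hfac := factorsThrough hx h hL hx0 k
  have hΦf : Function.FactorsThrough Φ (history I c (k + 1) (k + 2)) := fun ω ω' hh => by
    have e1 := hfac.mono_history le_rfl (Nat.le_succ _) hh
    have e3 : c (k + 1) ω = c (k + 1) ω' :=
      congrFun (Prod.ext_iff.1 hh).2 ⟨k + 1, Nat.lt_succ_self _⟩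
    simp only [Prod.mk.injEq] at e1
    simp only [hΦ, hw, he, hδ, e1.1, e1.2.1, e1.2.2, e3]
  have hΨf : Function.FactorsThrough (fun ω (t : Bool) => if t then 0 else Ψ ω)
      (history I c (k + 1) (k + 1)) := fun ω ω' hh => by
    have e1 := hfac hh
    simp only [Prod.mk.injEq] at e1
    simp only [hΨ, hw, he, hδ, e1.1, e1.2.1, e1.2.2]
  have hint : errSq P f x (sarahGrad f I c x) (k + 1) = (1 - 1 / (m : ℝ)) * ∫ ω, Ψ ω ∂P := by
    unfold errSq
    simp only [hpath]
    rw [hc.integral_batch hI le_rfl hΦf]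
    have hinner : ∀ ω, ∫ ω', Φ ω (I (k + 1) ω') ∂P = if c (k + 1) ω then 0 else Ψ ω := by
      intro ω
      simp only [hΦ]
      split_ifs with hcoin
      · simp
      · exact hI.integral_norm_add_avg_sq hb (k + 1) (e ω) (sum_avg_sub_eq_zero hn (δ ω))
    simp only [hinner]
    rw [hc.integral_coin_history hI (p := k + 1) le_rfl hΨf, ← integral_const_mul]
    simp
  have hbound : ∀ ω, Ψ ω ≤ ‖avgGrad f (x k ω) - sarahGrad f I c x k ω‖ ^ 2 + 1 / (b : ℝ) *
      (L ^ 2 * ‖x (k + 1) ω - x k ω‖ ^ 2 - ‖avgGrad f (x (k + 1) ω) - avgGrad f (x k ω)‖ ^ 2) := by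
    intro ω
    simp only [hΨ, hw]
    rw [avg_norm_avg_sub_sq hn, hδavg]
    have := h.basic.avgSmooth (x (k + 1) ω) (x k ω)
    gcongr
  have i1 := integrable_state hx h hL hx0 hI hc k fun y g _ => ‖avgGrad f y - g‖ ^ 2
  have i2 := integrable_state hx h hL hx0 hI hc k fun y _ y' => L ^ 2 * ‖y' - y‖ ^ 2
  have i3 := integrable_state hx h hL hx0 hI hc k fun y _ y' => ‖avgGrad f y' - avgGrad f y‖ ^ 2
  have i4 := integrable_state hx h hL hx0 hI hc k fun y g y' =>
    ‖avgGrad f y - g‖ ^ 2 + 1 / (b : ℝ) * ((1 / (n : ℝ)) * ∑ i, ‖(1 / (n : ℝ)) • ∑ l,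
      (gradient (f l) y' - gradient (f l) y) - (gradient (f i) y' - gradient (f i) y)‖ ^ 2)
  have i5 : Integrable (fun ω => 1 / (b : ℝ) * (L ^ 2 * ‖x (k + 1) ω - x k ω‖ ^ 2
      - ‖avgGrad f (x (k + 1) ω) - avgGrad f (x k ω)‖ ^ 2)) P := (i2.sub i3).const_mul _
  have h1 := integral_mono i4 (i1.fun_add i5) hbound
  rw [integral_add i1 i5, integral_const_mul, integral_sub i2 i3, integral_const_mul] at h1
  rw [hint, ← mul_add]
  exact mul_le_mul_of_nonneg_left h1 hm1

theorem sum_bounds (hn : 0 < n) (hm : 0 < m) (hbm : 4 * m ≤ b) (K : ℕ) :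
    ∑ k ∈ Finset.range K, stepSq P x k ≤ 100 * D / L ∧
    ∑ k ∈ Finset.range K, errSq P f x (sarahGrad f I c x) k ≤
      L ^ 2 / 2 * ∑ k ∈ Finset.range K, stepSq P x k := by
  have hb : 0 < b := by omega
  have hm' : (0 : ℝ) < m := by exact_mod_cast hm
  have hb' : (0 : ℝ) < b := by exact_mod_cast hb
  have hbm' : 4 * (m : ℝ) ≤ b := by exact_mod_cast hbm
  have hm1 : (1 : ℝ) ≤ m := by exact_mod_cast hm
  have hrec := sum_le_of_recursion (s := errSq P f x (sarahGrad f I c x))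
    (by simp [errSq, sarahGrad, sarahEst]) (fun k => integral_nonneg fun ω => by positivity)
    (errSq_succ_le hx h hL hx0 hI hc hn hb hm) K
  rw [← Finset.mul_sum, ← Finset.mul_sum, Finset.sum_sub_distrib, ← Finset.mul_sum] at hrec
  have hdnn : 0 ≤ ∑ k ∈ Finset.range K, stepSq P x k :=
    Finset.sum_nonneg fun k _ => integral_nonneg fun ω => by positivity
  have htnn : 0 ≤ ∑ k ∈ Finset.range K, gradStepSq P f x k :=
    Finset.sum_nonneg fun k _ => integral_nonneg fun ω => by positivity
  have htd : ∑ k ∈ Finset.range K, gradStepSq P f x k ≤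
      L ^ 2 * ∑ k ∈ Finset.range K, stepSq P x k := by
    rw [Finset.mul_sum]
    refine Finset.sum_le_sum fun k _ => ?_
    rw [gradStepSq, stepSq, ← integral_const_mul]
    exact integral_mono
      (integrable_state hx h hL hx0 hI hc k fun y _ y' => ‖avgGrad f y' - avgGrad f y‖ ^ 2)
      (integrable_state hx h hL hx0 hI hc k fun y _ y' => L ^ 2 * ‖y' - y‖ ^ 2)
      fun ω => h.basic.norm_avgGrad_sub_sq_le _ _
  set A := ∑ k ∈ Finset.range K, errSq P f x (sarahGrad f I c x) k with hA
  set Z := ∑ k ∈ Finset.range K, stepSq P x k with hZ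
  set G := ∑ k ∈ Finset.range K, gradStepSq P f x k with hG
  -- The recursion gives the factor `m * (1 - 1 / m) / b = (m - 1) / b`, which is at most `1 / 4` by
  -- `4 * m ≤ b`.
  have hAle : A ≤ (L ^ 2 * Z - G) / 4 := by
    have e1 : A ≤ ((m : ℝ) - 1) / b * (L ^ 2 * Z - G) := by
      have := mul_le_mul_of_nonneg_left hrec hm'.le
      calc A = m * ((1 - (1 - 1 / (m : ℝ))) * A) := by field_simp; ring
        _ ≤ _ := this
        _ = _ := by field_simp
    have e2 : ((m : ℝ) - 1) / b ≤ 1 / 4 := by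
      rw [div_le_iff₀ hb']; linarith
    have := mul_le_mul_of_nonneg_right e2 (sub_nonneg.2 htd)
    linarith
  have hdec := h.sum_le_of_decrease hx0 (g := sarahGrad f I c x) hx
    (fun k => integrable_state hx h hL hx0 hI hc k fun y _ _ => objVal f r y)
    (p := fun k => 5 / 16 * L * stepSq P x k - 1 / L * errSq P f x (sarahGrad f I c x) k
      - 1 / (4 * L) * gradStepSq P f x k) (fun k => by
      have i1 := integrable_state hx h hL hx0 hI hc k fun y _ _ => objVal f r y
      have i2 := integrable_state hx h hL hx0 hI hc k fun y g _ => 1 / L * ‖avgGrad f y - g‖ ^ 2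
      have i3 := integrable_state hx h hL hx0 hI hc k fun y _ y' =>
        1 / (4 * L) * ‖avgGrad f y' - avgGrad f y‖ ^ 2
      have i4 := integrable_state hx h hL hx0 hI hc k fun y _ y' => 5 / 16 * L * ‖y' - y‖ ^ 2
      have h1 := integral_mono
        (integrable_state hx h hL hx0 hI hc k fun _ _ y' => objVal f r y')
        (integrable_state hx h hL hx0 hI hc k fun y g y' => objVal f r y
          + 1 / L * ‖avgGrad f y - g‖ ^ 2 + 1 / (4 * L) * ‖avgGrad f y' - avgGrad f y‖ ^ 2
          - 5 / 16 * L * ‖y' - y‖ ^ 2) fun ω => by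
          simp only [one_div_mul_eq_div]
          exact h.objVal_step_le_norm hL (h.reg_ne_top (hx0 ω) (hx ω) k) (hx ω k)
      rw [integral_sub ((i1.fun_add i2).fun_add i3) i4, integral_add (i1.fun_add i2) i3,
        integral_add i1 i2, integral_const_mul, integral_const_mul, integral_const_mul] at h1
      have e1 : stepSq P x k = ∫ ω, ‖x (k + 1) ω - x k ω‖ ^ 2 ∂P := rfl
      have e2 : errSq P f x (sarahGrad f I c x) k =
        ∫ ω, ‖avgGrad f (x k ω) - sarahGrad f I c x k ω‖ ^ 2 ∂P := rfl
      have e3 : gradStepSq P f x k =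
        ∫ ω, ‖avgGrad f (x (k + 1) ω) - avgGrad f (x k ω)‖ ^ 2 ∂P := rfl
      rw [← e1, ← e2, ← e3] at h1
      linarith) K
  rw [Finset.sum_sub_distrib, Finset.sum_sub_distrib, ← Finset.mul_sum, ← Finset.mul_sum,
    ← Finset.mul_sum, ← hA, ← hZ, ← hG] at hdec
  refine ⟨?_, by nlinarith [mul_nonneg (sq_nonneg L) hdnn]⟩
  -- Here `G` cancels exactly, leaving `(5/16 - 1/4) * L * Z = L * Z / 16 ≤ D`.
  have e1 : 1 / L * A ≤ 1 / L * ((L ^ 2 * Z - G) / 4) := by gcongr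
  have e2 : 1 / L * ((L ^ 2 * Z - G) / 4) = L / 4 * Z - 1 / (4 * L) * G := by field_simp
  have e3 : 0 ≤ L * Z := by positivity
  rw [le_div_iff₀ hL]
  linarith

theorem reachesStationary (hLu : 0 ≤ Lu) (hS : ∀ᵐ ω ∂P, ∀ k, x k ω ∈ S) (hn : 0 < n)
    (hm : 0 < m) (hbm : 4 * m ≤ b) {K : ℕ} (hK : 1 ≤ K) {ε : ℝ}
    (hε : (2 * (2 * L + Lu) ^ 2 + L ^ 2) * (100 * D / L) ≤ K * ε ^ 2) :
    ReachesStationary P (objective f r) x K ε := by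
  obtain ⟨h1, h2⟩ := sum_bounds hx h hL hx0 hI hc hn hm hbm K
  exact h.reachesStationary hL hLu hx0 hS (g := sarahGrad f I c x) hx
    (fun k => integrable_state hx h hL hx0 hI hc k fun y _ y' => ‖y' - y‖ ^ 2)
    (fun k => integrable_state hx h hL hx0 hI hc k fun y g _ => ‖avgGrad f y - g‖ ^ 2) hK h1 h2 hε

end IsMMSarah

end Runs

/-! ### The parameter choices -/

/-- Cubing turns the floor of a fractional power into inequalities between integers. -/
theorem sagaB_rpow_cube (n : ℕ) :
    ((4 : ℝ) ^ (2 / 3 : ℝ) * (n : ℝ) ^ (2 / 3 : ℝ)) ^ 3 = 16 * (n : ℝ) ^ 2 := by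
  have h : ∀ a : ℝ, 0 ≤ a → (a ^ (2 / 3 : ℝ)) ^ 3 = a ^ 2 := fun a ha => by
    rw [← Real.rpow_natCast, ← Real.rpow_mul ha, ← Real.rpow_natCast]
    norm_num
  rw [mul_pow, h 4 (by norm_num), h n (by positivity)]
  norm_num

theorem sagaB_cube_le (n : ℕ) : sagaB n ^ 3 ≤ 16 * n ^ 2 := by
  have h : (sagaB n : ℝ) ≤ (4 : ℝ) ^ (2 / 3 : ℝ) * (n : ℝ) ^ (2 / 3 : ℝ) :=
    Nat.floor_le (by positivity)
  have h2 := pow_le_pow_left₀ (by positivity) h 3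
  rw [sagaB_rpow_cube] at h2
  exact_mod_cast h2

theorem lt_sagaB_succ_cube (n : ℕ) : 16 * n ^ 2 < (sagaB n + 1) ^ 3 := by
  have h : (4 : ℝ) ^ (2 / 3 : ℝ) * (n : ℝ) ^ (2 / 3 : ℝ) < (sagaB n : ℝ) + 1 :=
    Nat.lt_floor_add_one _
  have h2 := pow_lt_pow_left₀ h (by positivity) three_ne_zero
  rw [sagaB_rpow_cube] at h2
  exact_mod_cast h2

theorem sagaCond_pos {L : ℝ} (hL : 0 < L) {n : ℕ} (hn : 1 ≤ n) : 0 < sagaCond L L n (sagaB n) := by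
  have h1 := sagaB_cube_le n
  have h2 := lt_sagaB_succ_cube n
  set b := sagaB n with hb
  -- As `16 * n ^ 2 < (b + 1) ^ 3`, it suffices that `3 * b ^ 2 + 3 * b + 1 ≤ 8 * n * b`, which
  -- follows from `b ≤ 2 * n` for `n ≥ 2`; `n = 1` is separate.
  have key : 16 * n ^ 2 < b ^ 3 + 8 * n * b := by
    rcases hn.eq_or_lt with rfl | hn2
    · have hb1 : 2 ≤ b := by
        by_contra hlt
        have : b + 1 ≤ 2 := by omega
        have := Nat.pow_le_pow_left this 3
        omega
      have := Nat.pow_le_pow_left hb1 3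
      omega
    · have hn2 : 2 ≤ n := hn2
      have hb4 : 4 ≤ b := by
        by_contra hlt
        have e1 : b + 1 ≤ 4 := by omega
        have := Nat.pow_le_pow_left e1 3
        nlinarith
      have hb2n : b ≤ 2 * n := by
        by_contra hlt
        have e1 : 2 * n + 1 ≤ b := by omega
        have := Nat.pow_le_pow_left e1 3
        nlinarith
      nlinarith
  have hb0 : 0 < b := by
    rcases Nat.eq_zero_or_pos b with h0 | h0
    · rw [h0] at key h2
      nlinarith
    · exact h0
  have hb' : (0 : ℝ) < b := by exact_mod_cast hb0
  have hn' : (0 : ℝ) < n := by exact_mod_cast hn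
  have key' : 16 * (n : ℝ) ^ 2 < (b : ℝ) ^ 3 + 8 * n * b := by exact_mod_cast key
  have e : sagaCond L L n b =
      L ^ 2 * ((b : ℝ) ^ 3 + 8 * n * b - 16 * (n : ℝ) ^ 2) / (b : ℝ) ^ 3 := by
    unfold sagaCond condLHS
    field_simp
    ring
  rw [e]
  have : 0 < (b : ℝ) ^ 3 + 8 * n * b - 16 * (n : ℝ) ^ 2 := by linarith
  positivity

theorem svrgM_sq_le (n : ℕ) : 16 * svrgM n ^ 2 ≤ svrgB n := by
  have h : (svrgM n : ℝ) ≤ √(svrgB n : ℝ) / 4 := Nat.floor_le (by positivity)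
  have h2 : 4 * (svrgM n : ℝ) ≤ √(svrgB n : ℝ) := by linarith
  have h3 := pow_le_pow_left₀ (by positivity) h2 2
  rw [Real.sq_sqrt (by positivity), mul_pow] at h3
  norm_num at h3
  exact_mod_cast h3

theorem svrgCond_pos {L : ℝ} (hL : 0 < L) {n : ℕ} (hm : 1 ≤ svrgM n) :
    0 < svrgCond L L (svrgB n) (svrgM n) := by
  have h := svrgM_sq_le n
  set m := svrgM n with hmdef
  set b := svrgB n with hbdef
  have hb0 : 0 < b := by nlinarith
  have hb' : (0 : ℝ) < b := by exact_mod_cast hb0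
  have hm' : (0 : ℝ) < m := by exact_mod_cast hm
  have h' : 16 * (m : ℝ) ^ 2 ≤ b := by exact_mod_cast h
  have e : svrgCond L L b m = L ^ 2 * (b - 16 * (m : ℝ) ^ 2 + 8 * m) / b := by
    unfold svrgCond condLHS
    field_simp
    ring
  rw [e]
  have : 0 < (b : ℝ) - 16 * (m : ℝ) ^ 2 + 8 * m := by linarith
  positivity

theorem four_mul_sarahM_le (n : ℕ) : 4 * sarahM n ≤ sarahB n := by
  have h : (sarahM n : ℝ) ≤ (sarahB n : ℝ) / 4 := Nat.floor_le (by positivity)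
  have h2 : 4 * (sarahM n : ℝ) ≤ sarahB n := by linarith
  exact_mod_cast h2

theorem sarahCond_eq {L : ℝ} {n : ℕ} (hm : 1 ≤ sarahM n) :
    sarahCond L L (sarahB n) (sarahM n) =
      L ^ 2 * ((sarahB n : ℝ) - 4 * sarahM n) / sarahB n := by
  have h := four_mul_sarahM_le n
  have hb' : (0 : ℝ) < sarahB n := by exact_mod_cast (by omega : 0 < sarahB n)
  have hm' : (0 : ℝ) < sarahM n := by exact_mod_cast hm
  unfold sarahCond condLHS
  field_simp
  ring

theorem sarahCond_nonneg {L : ℝ} {n : ℕ} (hm : 1 ≤ sarahM n) :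
    0 ≤ sarahCond L L (sarahB n) (sarahM n) := by
  rw [sarahCond_eq hm]
  have h : 4 * (sarahM n : ℝ) ≤ sarahB n := by exact_mod_cast four_mul_sarahM_le n
  have : 0 ≤ (sarahB n : ℝ) - 4 * sarahM n := by linarith
  positivity

theorem sarahCond_pos {L : ℝ} (hL : 0 < L) {n : ℕ} (hm : 1 ≤ sarahM n) (h4 : ¬4 ∣ sarahB n) :
    0 < sarahCond L L (sarahB n) (sarahM n) := by
  rw [sarahCond_eq hm]
  have h := four_mul_sarahM_le n
  have hlt : 4 * sarahM n < sarahB n := lt_of_le_of_ne h fun he => h4 ⟨_, he.symm⟩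
  have h' : 4 * (sarahM n : ℝ) < sarahB n := by exact_mod_cast hlt
  have hb' : (0 : ℝ) < sarahB n := by exact_mod_cast (by omega : 0 < sarahB n)
  have : 0 < (sarahB n : ℝ) - 4 * sarahM n := by linarith
  positivity

/-- The contraction factor of the reference table of MM-SAGA. -/
theorem exists_saga_factor {n : ℕ} (hbn : sagaB n < n) : 0 < sagaB n ∧ ∃ q : ℝ, 0 < q ∧ q < 1 ∧
    (1 - 1 / (n : ℝ)) ^ sagaB n ≤ q ^ 2 ∧ 1 / (sagaB n * (1 - q) ^ 2) ≤ 49 / 100 := by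
  have h2 := lt_sagaB_succ_cube n
  set b := sagaB n with hb
  -- `b < n` gives `16 * n ^ 2 < (b + 1) ^ 3 ≤ n ^ 3`. Then `16 * 17 ^ 2 > 16 ^ 3` yields `b ≥ 16`,
  -- which makes the rounding factor `(b + 1) / b` at most `17 / 16`.
  have hn17 : 17 ≤ n := by
    by_contra hlt
    have e1 : (b + 1) ^ 3 ≤ n ^ 3 := Nat.pow_le_pow_left hbn 3
    have e2 : n ≤ 16 := by omega
    nlinarith [Nat.mul_le_mul_right (n ^ 2) e2]
  have hb16 : 16 ≤ b := by
    by_contra hlt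
    have e1 : b + 1 ≤ 16 := by omega
    have := Nat.pow_le_pow_left e1 3
    nlinarith
  have hbR : (16 : ℝ) ≤ b := by exact_mod_cast hb16
  have hnR : (17 : ℝ) ≤ n := by exact_mod_cast hn17
  have hbnR : (b : ℝ) ≤ n := by exact_mod_cast hbn.le
  have h2R : 16 * (n : ℝ) ^ 2 < ((b : ℝ) + 1) ^ 3 := by exact_mod_cast h2
  have hn0 : (0 : ℝ) < n := by linarith
  have hb0 : (0 : ℝ) < b := by linarith
  refine ⟨by omega, ?_⟩
  -- With `q = exp (-t)`, the survival probability satisfies `(1 - 1 / n) ^ b ≤ exp (-b / n) = q ^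
  -- 2`.
  set t : ℝ := b / (2 * n) with ht
  have ht0 : 0 < t := by positivity
  have ht1 : t ≤ 1 / 2 := by
    rw [ht, div_le_iff₀ (by positivity)]
    linarith
  have hexp : 1 + t + t ^ 2 / 2 + t ^ 3 / 6 ≤ Real.exp t := by
    have := Real.sum_le_exp_of_nonneg ht0.le 4
    simp [Finset.sum_range_succ, Nat.factorial] at this
    linarith
  -- The constant lies just below the slope `2 * (1 - exp (-1/2)) ≈ 0.787` of the chord over `[0,
  -- 1/2]`, and is still large enough for the bound `49 / 100` after the rounding loss.
  have hq1 : Real.exp (-t) ≤ 1 - 783 / 1000 * t := by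
    rw [Real.exp_neg, inv_le_comm₀ (Real.exp_pos t) (by linarith)]
    refine le_trans ?_ hexp
    rw [inv_le_iff_one_le_mul₀ (by linarith)]
    have e : (1 + t + t ^ 2 / 2 + t ^ 3 / 6) * (1 - 783 / 1000 * t) =
        1 + t * (217 / 1000 - 283 / 1000 * t - 1349 / 6000 * t ^ 2 - 783 / 6000 * t ^ 3) := by ring
    rw [e]
    have e1 : t ^ 2 ≤ 1 / 4 := by nlinarith
    have e2 : t ^ 3 ≤ 1 / 8 := by nlinarith
    have : 0 ≤ 217 / 1000 - 283 / 1000 * t - 1349 / 6000 * t ^ 2 - 783 / 6000 * t ^ 3 := by linarith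
    nlinarith
  refine ⟨Real.exp (-t), Real.exp_pos _, by linarith, ?_, ?_⟩
  · have e1 : 0 ≤ 1 - 1 / (n : ℝ) := by
      rw [sub_nonneg, div_le_one hn0]; linarith
    calc (1 - 1 / (n : ℝ)) ^ b ≤ Real.exp (-(1 / (n : ℝ))) ^ b :=
          pow_le_pow_left₀ e1 (Real.one_sub_le_exp_neg _) b
      _ = Real.exp (-t) ^ 2 := by
          rw [← Real.exp_nat_mul, ← Real.exp_nat_mul, ht]
          congr 1
          field_simp
          norm_num
  · have e1 : (783 / 1000 * t) ^ 2 ≤ (1 - Real.exp (-t)) ^ 2 :=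
      pow_le_pow_left₀ (by positivity) (by linarith) 2
    have e2 : 65536 * (n : ℝ) ^ 2 ≤ 4913 * (b : ℝ) ^ 3 := by
      have : ((b : ℝ) + 1) ^ 3 ≤ (17 / 16 * b) ^ 3 :=
        pow_le_pow_left₀ (by positivity) (by linarith) 3
      nlinarith
    have e3 : 100 / 49 ≤ b * (783 / 1000 * t) ^ 2 := by
      rw [ht]
      have : b * (783 / 1000 * (b / (2 * (n : ℝ)))) ^ 2 =
          783 ^ 2 * (b : ℝ) ^ 3 / (4000000 * (n : ℝ) ^ 2) := by field_simp; norm_num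
      rw [this, le_div_iff₀ (by positivity)]
      nlinarith
    have e4 : 100 / 49 ≤ b * (1 - Real.exp (-t)) ^ 2 :=
      e3.trans (mul_le_mul_of_nonneg_left e1 hb0.le)
    rw [div_le_iff₀ (by linarith)]
    linarith

theorem svrg_cost_le {n : ℕ} (hm : 1 ≤ svrgM n) :
    2 * (svrgB n : ℝ) + n * (svrgM n : ℝ)⁻¹ ≤ 14 * (n : ℝ) ^ (2 / 3 : ℝ) := by
  have h1 := svrgM_sq_le n
  have hm' : (1 : ℝ) ≤ svrgM n := by exact_mod_cast hm
  have hb1 : (1 : ℝ) ≤ svrgB n := by exact_mod_cast (by nlinarith : 1 ≤ svrgB n)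
  have h2 : √(svrgB n : ℝ) / 4 < svrgM n + 1 := Nat.lt_floor_add_one _
  set y := (n : ℝ) ^ (2 / 3 : ℝ) with hy
  have hy0 : 0 ≤ y := by positivity
  have h3 : (svrgB n : ℝ) ≤ y := Nat.floor_le hy0
  have h4 : y < svrgB n + 1 := Nat.lt_floor_add_one _
  have hn : (n : ℝ) = y * √y := by
    rw [hy, Real.sqrt_eq_rpow, ← Real.rpow_mul (by positivity), ← Real.rpow_add' (by positivity)]
    · norm_num
    · norm_num
  -- Since `m ≥ 1`, `√b < 4 * (m + 1) ≤ 8 * m`, so `y < b + 1 ≤ 64 * m ^ 2 + 1 ≤ 144 * m ^ 2`. With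
  -- `n = y * √y` this gives `n / m ≤ 12 * y`.
  have h5 : √y ≤ 12 * svrgM n := by
    refine Real.sqrt_le_iff.2 ⟨by positivity, ?_⟩
    have e1 : √(svrgB n : ℝ) ≤ 8 * svrgM n := by linarith
    have e2 := (Real.sqrt_le_iff.1 e1).2
    nlinarith
  have h6 : n * (svrgM n : ℝ)⁻¹ ≤ 12 * y := by
    rw [← div_eq_mul_inv, div_le_iff₀ (by linarith)]
    nlinarith [mul_le_mul_of_nonneg_left h5 hy0]
  linarith

theorem sarah_cost_le {n : ℕ} (hm : 1 ≤ sarahM n) :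
    2 * (sarahB n : ℝ) + n * (sarahM n : ℝ)⁻¹ ≤ 14 * (n : ℝ) ^ (1 / 2 : ℝ) := by
  have hm' : (1 : ℝ) ≤ sarahM n := by exact_mod_cast hm
  have h2 : (sarahB n : ℝ) / 4 < sarahM n + 1 := Nat.lt_floor_add_one _
  have h2' : sarahB n + 1 ≤ 8 * sarahM n := by
    have : (sarahB n : ℝ) < 8 * sarahM n := by linarith
    have : sarahB n < 8 * sarahM n := by exact_mod_cast this
    omega
  have h2'' : (sarahB n : ℝ) + 1 ≤ 8 * sarahM n := by exact_mod_cast h2'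
  set y := (n : ℝ) ^ (1 / 2 : ℝ) with hy
  have hy0 : 0 ≤ y := by positivity
  have h3 : (sarahB n : ℝ) ≤ y := Nat.floor_le hy0
  have h4 : y < sarahB n + 1 := Nat.lt_floor_add_one _
  have hn : (n : ℝ) = y * y := by
    rw [hy, ← Real.sqrt_eq_rpow, Real.mul_self_sqrt (by positivity)]
  have h6 : n * (sarahM n : ℝ)⁻¹ ≤ 8 * y := by
    rw [← div_eq_mul_inv, div_le_iff₀ (by linarith)]
    nlinarith
  linarith

/-! ### Expected costs -/

section Cost

variable {Ω : Type*} [MeasurableSpace Ω] {P : Measure Ω} [IsProbabilityMeasure P] {n b m : ℕ}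
  {I : ℕ → Ω → Fin b → Fin n} {c : ℕ → Ω → Bool}

theorem IsCoin.lintegral_sum_coin_le (hc : IsCoin P I m c) (hm : 0 < m) (s t : ℕ) (K : ℕ) :
    ∫⁻ ω, ∑ k ∈ Finset.range K, ((if c k ω then (s : ℝ≥0∞) else 0) + t) ∂P ≤
      ENNReal.ofReal (K * (t + s * (m : ℝ)⁻¹)) := by
  have hmeas : ∀ k, Measurable fun ω => (if c k ω then (s : ℝ≥0∞) else 0) := fun k =>
    Measurable.ite (hc.measurable k (measurableSet_singleton true)) measurable_const
      measurable_const
  rw [lintegral_finsetSum _ fun k _ => (hmeas k).add_const _]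
  calc ∑ k ∈ Finset.range K, ∫⁻ ω, ((if c k ω then (s : ℝ≥0∞) else 0) + t) ∂P
      ≤ ∑ k ∈ Finset.range K, ((s : ℝ≥0∞) * (m : ℝ≥0∞)⁻¹ + t) := by
        refine Finset.sum_le_sum fun k _ => ?_
        rw [lintegral_add_right _ measurable_const, lintegral_const, measure_univ, mul_one]
        gcongr
        simpa using hc.lintegral_coin k (s : ℝ≥0∞) 0
    _ = ENNReal.ofReal (K * (t + s * (m : ℝ)⁻¹)) := by
        have hm' : (0 : ℝ) < m := by exact_mod_cast hm
        rw [Finset.sum_const, Finset.card_range, nsmul_eq_mul,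
          ENNReal.ofReal_mul (by positivity), ENNReal.ofReal_add (by positivity) (by positivity),
          ENNReal.ofReal_mul (by positivity), ENNReal.ofReal_inv_of_pos hm',
          ENNReal.ofReal_natCast, ENNReal.ofReal_natCast, ENNReal.ofReal_natCast,
          ENNReal.ofReal_natCast, add_comm]

theorem IsCoin.lintegral_svrgCost_le (hc : IsCoin P I m c) (hm : 0 < m) (K : ℕ) :
    ∫⁻ ω, (svrgCost n b (fun k => c k ω) K : ℝ≥0∞) ∂P ≤
      ENNReal.ofReal (K * (2 * b + n * (m : ℝ)⁻¹)) := by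
  have h := hc.lintegral_sum_coin_le hm n (2 * b) K
  push_cast at h
  refine le_trans (lintegral_mono fun ω => ?_) h
  rw [svrgCost]
  push_cast
  refine Finset.sum_le_sum fun k _ => ?_
  rw [add_comm]

/-- Charging `2 * b` even to full-gradient iterations costs only a constant factor and reduces to
the SVRG count. -/
theorem IsCoin.lintegral_sarahCost_le (hc : IsCoin P I m c) (hm : 0 < m) (K : ℕ) :
    ∫⁻ ω, (sarahCost n b (fun k => c k ω) K : ℝ≥0∞) ∂P ≤
      ENNReal.ofReal (K * (2 * b + n * (m : ℝ)⁻¹)) := by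
  have h := hc.lintegral_sum_coin_le hm n (2 * b) K
  push_cast at h
  refine le_trans (lintegral_mono fun ω => ?_) h
  rw [sarahCost]
  push_cast
  refine Finset.sum_le_sum fun k _ => ?_
  split_ifs
  · exact le_self_add
  · rw [zero_add]

end Cost

/-! ### The main theorem -/

theorem mainTheorem3 :
    -- the parameter choices satisfy the convergence condition (with equality allowed for MM-SARAH)
    (∀ L : ℝ, 0 < L →
      (∀ n : ℕ, 1 ≤ n → 0 < sagaCond L L n (sagaB n)) ∧
      (∀ n : ℕ, 1 ≤ svrgM n → 0 < svrgCond L L (svrgB n) (svrgM n)) ∧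
      (∀ n : ℕ, 1 ≤ sarahM n → 0 ≤ sarahCond L L (sarahB n) (sarahM n) ∧
        (¬ 4 ∣ sarahB n → 0 < sarahCond L L (sarahB n) (sarahM n)))) ∧
    -- the complexity bounds; `C` depends on `L`, `Lu` and `D` only, `K` on them and on `ε`
    (∀ L Lu D : ℝ, 0 < L → 0 ≤ Lu → 0 ≤ D → ∃ C : ℝ, 0 < C ∧
      ∀ ε : ℝ, 0 < ε → ε ≤ 1 → ∃ K : ℕ, 1 ≤ K ∧ (K : ℝ) ≤ C / ε ^ 2 ∧
      ∀ (n d : ℕ) (f : Fin n → EucSp d → ℝ) (r : EucSp d → EReal)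
        (u : EucSp d → EucSp d → EReal) (S : Set (EucSp d)) (x0 : EucSp d),
        ProblemAssumption f r u S x0 L Lu D →
      ∀ {Ω : Type*} [MeasurableSpace Ω] (P : Measure Ω) [IsProbabilityMeasure P]
        (x : ℕ → Ω → EucSp d), (∀ ω, x 0 ω = x0) → (∀ᵐ ω ∂P, ∀ k, x k ω ∈ S) →
      -- MM-SAGA
      (sagaB n < n → ∀ I : ℕ → Ω → Fin (sagaB n) → Fin n, IsSampling P I →
        (∀ ω, IsMMSaga f u L (fun k => I k ω) (fun k => x k ω)) →
        ReachesStationary P (objective f r) x K ε ∧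
        (sagaCost (sagaB n) K : ℝ) ≤ C * (n : ℝ) ^ (2 / 3 : ℝ) / ε ^ 2) ∧
      -- MM-SVRG
      (1 ≤ svrgM n → ∀ (I : ℕ → Ω → Fin (svrgB n) → Fin n) (c : ℕ → Ω → Bool),
        IsSampling P I → IsCoin P I (svrgM n) c →
        (∀ ω, IsMMSvrg f u L (fun k => I k ω) (fun k => c k ω) (fun k => x k ω)) →
        ReachesStationary P (objective f r) x K ε ∧
        ∫⁻ ω, (svrgCost n (svrgB n) (fun k => c k ω) K : ℝ≥0∞) ∂P ≤
          ENNReal.ofReal (C * (n : ℝ) ^ (2 / 3 : ℝ) / ε ^ 2)) ∧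
      -- MM-SARAH
      (1 ≤ sarahM n → ∀ (I : ℕ → Ω → Fin (sarahB n) → Fin n) (c : ℕ → Ω → Bool),
        IsSampling P I → IsCoin P I (sarahM n) c →
        (∀ ω, IsMMSarah f u L (fun k => I k ω) (fun k => c k ω) (fun k => x k ω)) →
        ReachesStationary P (objective f r) x K ε ∧
        ∫⁻ ω, (sarahCost n (sarahB n) (fun k => c k ω) K : ℝ≥0∞) ∂P ≤
          ENNReal.ofReal (C * (n : ℝ) ^ (1 / 2 : ℝ) / ε ^ 2))) := by

  refine ⟨fun L hL => ⟨fun n hn => sagaCond_pos hL hn, fun n hm => svrgCond_pos hL hm,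
    fun n hm => ⟨sarahCond_nonneg hm, sarahCond_pos hL hm⟩⟩, ?_⟩
  intro L Lu D hL hLu hD
  set C₀ : ℝ := (2 * (2 * L + Lu) ^ 2 + L ^ 2) * (100 * D / L) with hC₀
  have hC₀nn : 0 ≤ C₀ := by positivity
  -- `K` is the least natural number above `C₀ / ε ^ 2`; the extra `1` is absorbed by `ε ≤ 1`. The
  -- factor `20` exceeds `14`, which bounds the cost per iteration divided by the power of `n` for
  -- all three methods.
  refine ⟨20 * (C₀ + 1), by positivity, fun ε hε0 hε1 => ⟨⌊C₀ / ε ^ 2⌋₊ + 1, by omega, ?_⟩⟩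
  set K := ⌊C₀ / ε ^ 2⌋₊ + 1 with hK
  have hε2 : 0 < ε ^ 2 := by positivity
  have hKle : (K : ℝ) ≤ (C₀ + 1) / ε ^ 2 := by
    have h1 : (⌊C₀ / ε ^ 2⌋₊ : ℝ) ≤ C₀ / ε ^ 2 := Nat.floor_le (by positivity)
    have h2 : 1 ≤ 1 / ε ^ 2 := by
      rw [le_div_iff₀ hε2]
      nlinarith
    rw [hK, add_div]
    push_cast
    linarith
  have hKge : C₀ ≤ K * ε ^ 2 := by
    have h1 : C₀ / ε ^ 2 < K := by
      rw [hK]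
      push_cast
      exact Nat.lt_floor_add_one _
    exact ((div_lt_iff₀ hε2).1 h1).le
  have hK1 : 1 ≤ K := by omega
  have hcost : ∀ s y : ℝ, 0 ≤ y → s ≤ 14 * y → K * s ≤ 20 * (C₀ + 1) * y / ε ^ 2 := by
    intro s y hy hs
    calc K * s ≤ K * (14 * y) := by gcongr
      _ ≤ (C₀ + 1) / ε ^ 2 * (14 * y) := by gcongr
      _ = 14 * ((C₀ + 1) * y / ε ^ 2) := by ring
      _ ≤ 20 * ((C₀ + 1) * y / ε ^ 2) := by gcongr; norm_num
      _ = _ := by ring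
  refine ⟨hKle.trans (by gcongr; linarith), ?_⟩
  intro n d f r u S x0 h Ω _ P _ x hx0 hS
  refine ⟨fun hbn I hI hx => ⟨?_, ?_⟩, fun hm I c hI hc hx => ⟨?_, ?_⟩,
    fun hm I c hI hc hx => ⟨?_, ?_⟩⟩
  · obtain ⟨hb, q, hq0, hq1, hq, hbq⟩ := exists_saga_factor hbn
    exact (isTableRun_saga hx).reachesStationary h hL hx0 hI (IsCoin.const_true I) hLu hS
      (by omega) hb hq1 hbq (saga_tableGap_recursion h hL hx0 hI hx hq0 hq1 hq) hK1 hKge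
  · have h4 : (4 : ℝ) ^ (2 / 3 : ℝ) ≤ 14 :=
      (Real.rpow_le_rpow_of_exponent_le (by norm_num) (by norm_num : (2 / 3 : ℝ) ≤ 1)).trans
        (by norm_num)
    have hb : (sagaB n : ℝ) ≤ (4 : ℝ) ^ (2 / 3 : ℝ) * (n : ℝ) ^ (2 / 3 : ℝ) :=
      Nat.floor_le (by positivity)
    rw [sagaCost, Finset.sum_const, Finset.card_range, smul_eq_mul, Nat.cast_mul]
    exact hcost _ _ (by positivity) (hb.trans (by gcongr))
  · have hbm := svrgM_sq_le n
    have hn : 0 < n := by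
      rcases Nat.eq_zero_or_pos n with rfl | hn
      · simp [svrgM, svrgB] at hm
      · exact hn
    have hm' : (1 : ℝ) ≤ svrgM n := by exact_mod_cast hm
    have hbm' : 16 * (svrgM n : ℝ) ^ 2 ≤ svrgB n := by exact_mod_cast hbm
    have hinv : 1 / (2 * (svrgM n : ℝ)) ≤ 1 / 2 := by
      rw [div_le_div_iff₀ (by positivity) (by norm_num)]
      linarith
    have hinv0 : 0 < 1 / (2 * (svrgM n : ℝ)) := by positivity
    -- With `q = 1 - 1 / (2 * m)`, `q ^ 2` exceeds `1 - 1 / m`, and `b * (1 - q) ^ 2 = b / (4 * m ^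
    -- 2) ≥ 4`.
    refine (isTableRun_svrg hx).reachesStationary h hL hx0 hI hc hLu hS hn (by nlinarith)
      (q := 1 - 1 / (2 * (svrgM n : ℝ))) (by linarith) ?_
      (svrg_tableGap_recursion h hL hx0 hI hc hx (by linarith) (by linarith) ?_) hK1 hKge
    · rw [sub_sub_cancel, div_le_iff₀ (mul_pos (by nlinarith) (pow_pos hinv0 2))]
      have : (svrgB n : ℝ) * (1 / (2 * (svrgM n : ℝ))) ^ 2 =
          svrgB n / (4 * (svrgM n : ℝ) ^ 2) := by field_simp; norm_num
      have h4 : 4 ≤ (svrgB n : ℝ) / (4 * (svrgM n : ℝ) ^ 2) := by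
        rw [le_div_iff₀ (by positivity)]
        linarith
      rw [this]
      linarith
    · have e : (1 - 1 / (2 * (svrgM n : ℝ))) ^ 2 =
          1 - 1 / (svrgM n : ℝ) + (1 / (2 * (svrgM n : ℝ))) ^ 2 := by field_simp; ring
      rw [e]
      linarith [pow_pos hinv0 2]
  · exact (hc.lintegral_svrgCost_le (by omega) K).trans
      (ENNReal.ofReal_le_ofReal (hcost _ _ (by positivity) (svrg_cost_le hm)))
  · have hn : 0 < n := by
      rcases Nat.eq_zero_or_pos n with rfl | hn
      · simp [sarahM, sarahB] at hm
      · exact hn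
    exact IsMMSarah.reachesStationary hx h hL hx0 hI hc hLu hS hn (by omega)
      (four_mul_sarahM_le n) hK1 hKge
  · exact (hc.lintegral_sarahCost_le (by omega) K).trans
      (ENNReal.ofReal_le_ofReal (hcost _ _ (by positivity) (sarah_cost_le hm)))
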